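/- For $\tau$ in the upper half plane let $q=e^{2\pi i\tau}$, let $$E_2=1-24\sum_{n\ge1}\frac{nq^n}{1-q^n},\qquad E_4=1+240\sum_{n\ge1}\frac{n^3q^n}{1-q^n},\qquad E_6=1-504\sum_{n\ge1}\frac{n^5q^n}{1-q^n}$$ be the Eisenstein series, let $\Delta=q\prod_{m\ge1}(1-q^m)^{24}=(E_4^3-E_6^2)/1728$, and let $\delta=\frac1{2\pi i}\frac{d}{d\tau}=q\frac{d}{dq}$. The meromorphic modular forms $\Delta/E_4^2$, $E_4\Delta/E_6^2$ and $E_6\Delta/E_4^3$ are holomorphic for $\operatorname{Im}\tau>1$ and vanish at $q=0$; for each such $F$ let $\delta^{-1}F=\int_0^qF\,\frac{dq}q$ be the anti-derivative of $F$ with respect to $\delta$ that vanishes at $q=0$, a holomorphic function on the half-plane $\operatorname{Im}\tau>1$. Put $$\tilde F_{4a}=\delta^{-1}\Bigl(\frac{\Delta}{E_4^2}\Bigr),\qquad \tilde F_{4b}=\delta^{-1}\Bigl(\frac{E_4\Delta}{E_6^2}\Bigr),\qquad \tilde F_6=\delta^{-1}\Bigl(\frac{E_6\Delta}{E_4^3}\Bigr).$$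 Let $\mathbb C\langle\tau,q,E_2,E_4,E_6,\tilde F_{4a},\tilde F_{4b},\tilde F_6\rangle$ be the differential field generated over $\mathbb C$ by these eight functions, that is, the smallest subfield of the field of meromorphic functions on $\operatorname{Im}\tau>1$ that contains $\mathbb C$ and the eight functions and is closed under $\delta$. Then this field has transcendence degree $8$ over $\mathbb C$. -/

import Mathlib

noncomputable section

namespace MagneticForms

open Complex MeasureTheory
open UpperHalfPlane hiding I
open scoped Real Manifold

section Fractions

variable {k A K : Type*} [Field k] [CommRing A] [IsDomain A] [Algebra k A] [Field K]
  [Algebra A K] [IsFractionRing A K]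

/-- The ring homomorphism `a ↦ a + (D a) ε` to the dual numbers over the field of fractions. -/
def jet (D : Derivation k A A) : A →+* TrivSqZeroExt K K where
  toFun a := TrivSqZeroExt.inl (algebraMap A K a) + TrivSqZeroExt.inr (algebraMap A K (D a))
  map_one' := by ext <;> simp
  map_zero' := by ext <;> simp
  map_add' a b := by
    ext
    · simp
    · simp only [map_add, TrivSqZeroExt.snd_add, TrivSqZeroExt.snd_inl, TrivSqZeroExt.snd_inr,
        zero_add]
  map_mul' a b := by
    ext
    · simp
    · simp only [Derivation.leibniz, smul_eq_mul, map_add, map_mul, TrivSqZeroExt.snd_add,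
        TrivSqZeroExt.snd_inl, TrivSqZeroExt.snd_inr, TrivSqZeroExt.snd_mul,
        TrivSqZeroExt.fst_add, TrivSqZeroExt.fst_inl, TrivSqZeroExt.fst_inr, zero_add, add_zero,
        op_smul_eq_smul, smul_eq_mul]

lemma isUnit_jet (D : Derivation k A A) (s : nonZeroDivisors A) :
    IsUnit (jet (K := K) D s) := by
  rw [TrivSqZeroExt.isUnit_iff_isUnit_fst]
  simp [jet]

/-- The extension of `jet D` to the field of fractions, `x ↦ x + (D x) ε`. -/
def jetFrac (D : Derivation k A A) : K →+* TrivSqZeroExt K K :=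
  IsLocalization.lift (M := nonZeroDivisors A) (g := jet (K := K) D) (isUnit_jet D)

lemma jetFrac_algebraMap (D : Derivation k A A) (a : A) :
    jetFrac (K := K) D (algebraMap A K a) = jet D a :=
  IsLocalization.lift_eq _ _

variable [Algebra k K]

lemma fst_jetFrac (D : Derivation k A A) (x : K) : (jetFrac (K := K) D x).fst = x := by
  have h : ((TrivSqZeroExt.fstHom k K K : TrivSqZeroExt K K →+* K).comp (jetFrac D)) =
      RingHom.id K := by
    refine IsLocalization.ringHom_ext (nonZeroDivisors A) (RingHom.ext fun a => ?_)
    simp [jetFrac_algebraMap, jet]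
  exact RingHom.congr_fun h x

variable [IsScalarTower k A K]

/-- The extension of a derivation of a domain to its field of fractions; it is the only one, and
satisfies the quotient rule. -/
def fracDerivation (D : Derivation k A A) : Derivation k K K := Derivation.mk'
  { toFun := fun x => (jetFrac D x).snd
    map_add' := fun x y => by simp
    map_smul' := fun c x => by
      have h : jetFrac (K := K) D (algebraMap k K c) = TrivSqZeroExt.inl (algebraMap k K c) := by
        rw [IsScalarTower.algebraMap_apply k A K, jetFrac_algebraMap]
        simp [jet]
      simp [Algebra.smul_def, h] }
  fun x y => by
    simp [fst_jetFrac, mul_comm]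

@[simp] lemma fracDerivation_algebraMap (D : Derivation k A A) (a : A) :
    fracDerivation D (algebraMap A K a) = algebraMap A K (D a) := by
  change (jetFrac D _).snd = _
  rw [jetFrac_algebraMap]
  change (TrivSqZeroExt.inl (algebraMap A K a) +
    TrivSqZeroExt.inr (algebraMap A K (D a)) : TrivSqZeroExt K K).snd = _
  rw [TrivSqZeroExt.snd_add, TrivSqZeroExt.snd_inl, TrivSqZeroExt.snd_inr, zero_add]

end Fractions

section Generated

variable {k K : Type*} [Field k] [Field K] [Algebra k K]

/-- The differential field `k⟨S⟩` generated by `S` inside `(K, D)`: the smallest intermediate field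
that contains `S` and is closed under `D`. -/
def differentialAdjoin (D : Derivation k K K) (S : Set K) : IntermediateField k K :=
  sInf {L | S ⊆ L ∧ ∀ x ∈ L, D x ∈ L}

lemma subset_differentialAdjoin (D : Derivation k K K) (S : Set K) :
    S ⊆ differentialAdjoin D S := fun x hx => by
  simp only [differentialAdjoin, SetLike.mem_coe, IntermediateField.mem_sInf]
  exact fun L hL => hL.1 hx

lemma map_mem_differentialAdjoin (D : Derivation k K K) (S : Set K) {x : K}
    (hx : x ∈ differentialAdjoin D S) : D x ∈ differentialAdjoin D S := by
  simp only [differentialAdjoin, IntermediateField.mem_sInf] at hx ⊢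
  exact fun L hL => hL.2 x (hx L hL)

end Generated

/-- The half-plane `Im τ > 1`. -/
def halfPlane : Set ℂ := {z | 1 < z.im}

lemma isOpen_halfPlane : IsOpen halfPlane := isOpen_lt continuous_const Complex.continuous_im

lemma isPreconnected_halfPlane : IsPreconnected halfPlane :=
  (convex_halfSpace_im_gt 1).isPreconnected

/-- The `ℂ`-algebra of holomorphic functions on the half-plane `Im τ > 1`. -/
def Hol : Subalgebra ℂ (halfPlane → ℂ) where
  carrier := {f | ∃ g : ℂ → ℂ, DifferentiableOn ℂ g halfPlane ∧ ∀ z, f z = g z}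
  mul_mem' := by
    rintro _ _ ⟨g, hg, h⟩ ⟨g', hg', h'⟩
    exact ⟨g * g', hg.mul hg', fun z => by simp [h, h']⟩
  add_mem' := by
    rintro _ _ ⟨g, hg, h⟩ ⟨g', hg', h'⟩
    exact ⟨g + g', hg.add hg', fun z => by simp [h, h']⟩
  algebraMap_mem' := fun c => ⟨fun _ => c, differentiableOn_const c, fun z => by simp⟩

/-- Extension by zero of a function on the half-plane to all of `ℂ`. -/
def ext (f : halfPlane → ℂ) : ℂ → ℂ := Function.extend Subtype.val f 0

lemma ext_apply (f : halfPlane → ℂ) (z : halfPlane) : ext f z = f z :=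
  Subtype.val_injective.extend_apply f 0 z

lemma ext_eqOn {f : halfPlane → ℂ} {g : ℂ → ℂ} (h : ∀ z : halfPlane, f z = g z) :
    Set.EqOn (ext f) g halfPlane := fun z hz => (ext_apply f ⟨z, hz⟩).trans (h ⟨z, hz⟩)

lemma ext_eventuallyEq {f : halfPlane → ℂ} {g : ℂ → ℂ} (h : ∀ z : halfPlane, f z = g z)
    (z : halfPlane) : ext f =ᶠ[nhds (z : ℂ)] g :=
  (ext_eqOn h).eventuallyEq_of_mem (isOpen_halfPlane.mem_nhds z.2)

lemma differentiableOn_ext {f : halfPlane → ℂ} (hf : f ∈ Hol) :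
    DifferentiableOn ℂ (ext f) halfPlane := by
  obtain ⟨g, hg, h⟩ := hf
  exact hg.congr (ext_eqOn h)

lemma differentiableAt_ext (f : Hol) (z : halfPlane) :
    DifferentiableAt ℂ (ext f) z :=
  (differentiableOn_ext f.2).differentiableAt (isOpen_halfPlane.mem_nhds z.2)

instance : Nonempty halfPlane := ⟨⟨2 * I, by simp [halfPlane]⟩⟩

instance : IsDomain Hol := by
  have : Nontrivial Hol := inferInstance
  have : NoZeroDivisors Hol := by
    refine ⟨fun {f g} hfg => ?_⟩
    have hf := (differentiableOn_ext f.2).analyticOnNhd isOpen_halfPlane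
    have hg := (differentiableOn_ext g.2).analyticOnNhd isOpen_halfPlane
    have key : ∀ z ∈ halfPlane, ext f z * ext g z = 0 := fun z hz => by
      rw [ext_apply _ ⟨z, hz⟩, ext_apply _ ⟨z, hz⟩]
      exact congrFun (congrArg Subtype.val hfg) ⟨z, hz⟩
    refine (AnalyticOnNhd.eq_zero_or_eq_zero_of_mul_eq_zero hf hg key
      isPreconnected_halfPlane).imp (fun h => ?_) (fun h => ?_) <;>
    · ext z
      simpa [ext_apply] using h z z.2
  exact NoZeroDivisors.to_isDomain _

/-- The derivation `δ = (2πi)⁻¹ d/dτ` on holomorphic functions. -/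
def deltaHol : Derivation ℂ Hol Hol := Derivation.mk'
  { toFun := fun f => ⟨fun z => (2 * π * I)⁻¹ * deriv (ext f) z,
      fun z => (2 * π * I)⁻¹ * deriv (ext f) z,
      ((differentiableOn_ext f.2).deriv isOpen_halfPlane).const_mul _, fun _ => rfl⟩
    map_add' := fun f g => by
      ext z
      have h : ext (f + g : Hol) =ᶠ[nhds (z : ℂ)] ext f + ext g :=
        ext_eventuallyEq (fun w => by simp [ext_apply]) z
      change (2 * π * I)⁻¹ * deriv (ext (f + g : Hol)) z =
        (2 * π * I)⁻¹ * deriv (ext f) z + (2 * π * I)⁻¹ * deriv (ext g) z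
      rw [h.deriv_eq, deriv_add (differentiableAt_ext f z) (differentiableAt_ext g z), mul_add]
    map_smul' := fun c f => by
      ext z
      have h : ext (c • f : Hol) =ᶠ[nhds (z : ℂ)] fun w => c * ext f w :=
        ext_eventuallyEq (fun w => by simp [ext_apply]) z
      simp only [h.deriv_eq, deriv_const_mul c (differentiableAt_ext f z)]
      simp
      ring }
  fun f g => by
    ext z
    have h : ext (f * g : Hol) =ᶠ[nhds (z : ℂ)] ext f * ext g :=
      ext_eventuallyEq (fun w => by simp [ext_apply]) z
    change (2 * π * I)⁻¹ * deriv (ext (f * g : Hol)) z =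
      f.1 z * ((2 * π * I)⁻¹ * deriv (ext g) z) + g.1 z * ((2 * π * I)⁻¹ * deriv (ext f) z)
    rw [h.deriv_eq, deriv_mul (differentiableAt_ext f z) (differentiableAt_ext g z),
      ext_apply, ext_apply]
    ring

/-- The field of meromorphic functions on the half-plane `Im τ > 1`, as the field of fractions of
the ring of holomorphic functions. -/
abbrev Mer : Type := FractionRing Hol

/-- The derivation `δ = (2πi)⁻¹ d/dτ` on meromorphic functions. -/
def delta : Derivation ℂ Mer Mer := fracDerivation deltaHol

/-- A point of the half-plane as a point of the upper half plane. -/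
def pt (z : halfPlane) : ℍ := ⟨z, zero_lt_one.trans z.2⟩

/-- Restriction to the half-plane `Im τ > 1` of a function holomorphic on the upper half plane. -/
def restrict (f : ℍ → ℂ) (hf : MDiff f) : Hol :=
  ⟨fun z => f (pt z), f ∘ ofComplex,
    (UpperHalfPlane.mdifferentiable_iff.mp hf).mono fun z (hz : 1 < z.im) => (zero_lt_one.trans hz : 0 < z.im),
    fun z => by
      rw [Function.comp_apply, ofComplex_apply_of_im_pos (zero_lt_one.trans z.2)]
      rfl⟩

/-- The point `τ + i t` lying `t` above `τ`. -/
def above (z : halfPlane) (t : ℝ) : ℍ := ofComplex (z + t * I)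

/-- The anti-derivative `(δ⁻¹ F)(τ) = ∫₀^q F dq/q`, the integral taken along the ray from `0` to
`q = exp (2πiτ)`, parametrised by `exp (2πi(τ + it)) = q exp (-2πt)`, so that `dq/q = -2π dt`. -/
def antiDeriv (F : ℍ → ℂ) (z : halfPlane) : ℂ :=
  2 * π * ∫ t in Set.Ioi (0 : ℝ), F (above z t)

/-- The meromorphic modular form `F_{4a} = Δ / E₄²`. -/
def F4a (τ : ℍ) : ℂ := ModularForm.discriminant τ / ModularForm.E₄ τ ^ 2

/-- The meromorphic modular form `F_{4b} = E₄ Δ / E₆²`. -/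
def F4b (τ : ℍ) : ℂ := ModularForm.E₄ τ * ModularForm.discriminant τ / ModularForm.E₆ τ ^ 2

/-- The meromorphic modular form `F₆ = E₆ Δ / E₄³`. -/
def F6 (τ : ℍ) : ℂ := ModularForm.E₆ τ * ModularForm.discriminant τ / ModularForm.E₄ τ ^ 3

/-- The radius `exp (-2π)` of the disc that corresponds to `Im τ > 1`. -/
def rad : ℝ := Real.exp (-(2 * π))

lemma rad_pos : 0 < rad := Real.exp_pos _

lemma norm_q (z : ℂ) : ‖cexp (2 * π * I * z)‖ = Real.exp (-(2 * π * z.im)) := by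
  rw [Complex.norm_exp]
  simp

lemma qParam_eq (z : ℂ) : Function.Periodic.qParam 1 z = cexp (2 * π * I * z) := by
  simp [Function.Periodic.qParam]

lemma norm_q_lt {z : ℂ} (hz : z ∈ halfPlane) : cexp (2 * π * I * z) ∈ Metric.ball (0 : ℂ) rad := by
  rw [mem_ball_zero_iff, norm_q, rad, Real.exp_lt_exp]
  have : (1 : ℝ) < z.im := hz
  nlinarith [Real.pi_pos]

lemma above_im (z : halfPlane) {t : ℝ} (ht : 0 ≤ t) : ((z : ℂ) + t * I) ∈ halfPlane := by
  have : (1 : ℝ) < (z : ℂ).im := z.2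
  simp [halfPlane]
  linarith

lemma coe_above (z : halfPlane) {t : ℝ} (ht : 0 ≤ t) : (above z t : ℂ) = z + t * I := by
  rw [above, ofComplex_apply_of_im_pos (zero_lt_one.trans (above_im z ht))]

lemma antiDeriv_eq {F : ℍ → ℂ} {G g : ℂ → ℂ} (hG : ∀ w ∈ Metric.ball (0 : ℂ) rad,
    HasDerivAt g (G w) w) (hc : ContinuousOn G (Metric.ball (0 : ℂ) rad)) (h0 : g 0 = 0)
    (hF : ∀ τ : ℍ, 1 < τ.im → F τ = cexp (2 * π * I * τ) * G (cexp (2 * π * I * τ)))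
    (z : halfPlane) : antiDeriv F z = g (cexp (2 * π * I * z)) := by
  set Q : ℝ → ℂ := fun t => cexp (2 * π * I * (z + t * I)) with hQ
  have hQball : ∀ t : ℝ, 0 ≤ t → Q t ∈ Metric.ball (0 : ℂ) rad := fun t ht =>
    norm_q_lt (above_im z ht)
  have hFQ : ∀ t : ℝ, 0 ≤ t → F (above z t) = Q t * G (Q t) := fun t ht => by
    have h1 : (1 : ℝ) < (above z t).im := by
      have := above_im z ht
      rw [← coe_above z ht] at this
      exact this
    rw [hF _ h1, coe_above z ht]
  have hnQ : ∀ t : ℝ, ‖Q t‖ = ‖Q 0‖ * Real.exp (-(2 * π) * t) := fun t => by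
    simp only [hQ, norm_q]
    rw [← Real.exp_add]
    congr 1
    simp
    ring
  have hQd : ∀ t : ℝ, HasDerivAt Q (-(2 * π) * Q t) t := fun t => by
    have h1 : HasDerivAt (fun t : ℝ => 2 * π * I * ((z : ℂ) + t * I)) (2 * π * I * (1 * I)) t :=
      (((Complex.ofRealCLM.hasDerivAt (x := t)).mul_const I).const_add (z : ℂ)).const_mul _
    have h2 := h1.cexp
    convert h2 using 1
    simp only [hQ]
    linear_combination (2 * π * cexp (2 * π * I * (z + t * I))) * (-I_sq)
  have hd : ∀ t ∈ Set.Ici (0 : ℝ), HasDerivAt (fun t => g (Q t))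
      (-(2 * π) * F (above z t)) t := fun t ht => by
    have := (hG _ (hQball t ht)).scomp t (hQd t)
    rw [smul_eq_mul, mul_assoc, ← hFQ t ht] at this
    exact this
  have hQc : Continuous Q := continuous_iff_continuousAt.mpr fun t => (hQd t).continuousAt
  have hQ0 : Filter.Tendsto Q Filter.atTop (nhds 0) := by
    rw [tendsto_zero_iff_norm_tendsto_zero, funext hnQ]
    have : Filter.Tendsto (fun t : ℝ => Real.exp (-(2 * π) * t)) Filter.atTop (nhds 0) :=
      Real.tendsto_exp_atBot.comp
        (Filter.tendsto_id.const_mul_atTop_of_neg (by linarith [Real.pi_pos]))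
    simpa using this.const_mul ‖Q 0‖
  have hr : (0 : ℂ) ∈ Metric.ball (0 : ℂ) rad := by
    simpa using rad_pos
  have ht : Filter.Tendsto (fun t => g (Q t)) Filter.atTop (nhds 0) := by
    have := (hG 0 hr).continuousAt.tendsto.comp hQ0
    rwa [h0] at this
  have hsub : Metric.closedBall (0 : ℂ) ‖Q 0‖ ⊆ Metric.ball 0 rad :=
    Metric.closedBall_subset_ball (mem_ball_zero_iff.mp (hQball 0 le_rfl))
  obtain ⟨C, hC⟩ := (isCompact_closedBall (0 : ℂ) ‖Q 0‖).exists_bound_of_continuousOn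
    (hc.mono hsub)
  have hint : IntegrableOn (fun t => -(2 * π) * F (above z t)) (Set.Ioi (0 : ℝ)) := by
    have hI : IntegrableOn (fun t : ℝ => 2 * π * (‖Q 0‖ * C) * Real.exp (-(2 * π) * t))
        (Set.Ioi (0 : ℝ)) :=
      (exp_neg_integrableOn_Ioi 0 (by linarith [Real.pi_pos] : (0 : ℝ) < 2 * π)).const_mul _
    refine hI.mono' ?_ ?_
    · refine ContinuousOn.aestronglyMeasurable ?_ measurableSet_Ioi
      have hcont : ContinuousOn (fun t => -(2 * π) * (Q t * G (Q t))) (Set.Ioi (0 : ℝ)) :=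
        continuousOn_const.mul (hQc.continuousOn.mul
          (hc.comp hQc.continuousOn fun t ht => hQball t (le_of_lt ht)))
      exact hcont.congr fun t ht => by rw [hFQ t (le_of_lt ht)]
    · refine (ae_restrict_iff' measurableSet_Ioi).mpr (Filter.Eventually.of_forall fun t ht => ?_)
      have ht' : (0 : ℝ) ≤ t := le_of_lt ht
      rw [hFQ t ht', norm_mul, norm_mul, hnQ]
      have hb : ‖G (Q t)‖ ≤ C := hC _ (by
        rw [mem_closedBall_zero_iff, hnQ]
        refine mul_le_of_le_one_right (norm_nonneg _) (Real.exp_le_one_iff.mpr ?_)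
        nlinarith [Real.pi_pos])
      have hp : ‖(-(2 * π) : ℂ)‖ = 2 * π := by
        simp [abs_of_pos Real.pi_pos]
      rw [hp]
      have : 0 ≤ 2 * π * (‖Q 0‖ * Real.exp (-(2 * π) * t)) := by positivity
      nlinarith [mul_le_mul_of_nonneg_left hb this]
  have := integral_Ioi_of_hasDerivAt_of_tendsto' hd hint ht
  rw [integral_const_mul] at this
  have hq : Q 0 = cexp (2 * π * I * z) := by simp [hQ]
  rw [← hq, antiDeriv]
  linear_combination -this

/-- The function of `q` that a level one modular form is. -/
abbrev cusp (f : ℍ → ℂ) : ℂ → ℂ := cuspFunction 1 f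

section Level1

open ModularForm MatrixGroups

lemma cusp_q {k : ℤ} (f : ModularForm 𝒮ℒ k) (τ : ℍ) : cusp f (cexp (2 * π * I * τ)) = f τ := by
  rw [← qParam_eq]
  exact SlashInvariantFormClass.eq_cuspFunction f τ one_mem_strictPeriods_SL one_ne_zero

lemma cusp_q_discriminant (τ : ℍ) :
    cusp discriminant (cexp (2 * π * I * τ)) = discriminant τ := by
  rw [← qParam_eq]
  exact SlashInvariantFormClass.eq_cuspFunction CuspForm.discriminant τ one_mem_strictPeriods_SL
    one_ne_zero

lemma rad_lt_one : rad < 1 := by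
  rw [rad, Real.exp_lt_one_iff]
  linarith [Real.pi_pos]

lemma differentiableOn_cusp {F : Type*} [FunLike F ℍ ℂ] {k : ℤ} [ModularFormClass F 𝒮ℒ k] (f : F) :
    DifferentiableOn ℂ (cusp f) (Metric.ball 0 rad) := fun _ hw =>
  (ModularFormClass.differentiableAt_cuspFunction f one_pos one_mem_strictPeriods_SL
    ((mem_ball_zero_iff.mp hw).trans rad_lt_one)).differentiableWithinAt

lemma hasSum_cusp {k : ℕ} (hk : 3 ≤ k) (hk2 : Even k) {w : ℂ} (hw : ‖w‖ < 1) :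
    HasSum (fun m : ℕ => -(2 * k / bernoulli k : ℂ) *
      (ArithmeticFunction.sigma (k - 1) (m + 1)) * w ^ (m + 1)) (cusp (E hk) w - 1) := by
  have : Fact (IsCusp OnePoint.infty 𝒮ℒ) :=
    ⟨Subgroup.isCusp_of_mem_strictPeriods one_pos one_mem_strictPeriods_SL⟩
  have h := hasSum_qExpansion_of_norm_lt one_pos
    (SlashInvariantFormClass.periodic_comp_ofComplex (E hk) one_mem_strictPeriods_SL)
    (ModularFormClass.holo (E hk)) (ModularFormClass.bdd_at_infty (E hk)) hw
  rw [← hasSum_nat_add_iff' 1] at h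
  simpa [EisensteinSeries.E_qExpansion_coeff hk hk2] using h

lemma E₆_I : E₆ UpperHalfPlane.I = 0 := by
  have : SlashInvariantFormClass (ModularForm 𝒮ℒ 6) (CongruenceSubgroup.Gamma 1) 6 :=
    CongruenceSubgroup.Gamma_one_coe_eq_SL ▸ inferInstance
  have h := SlashInvariantForm.slash_action_eqn_SL'' E₆
    (CongruenceSubgroup.mem_Gamma_one ModularGroup.S) UpperHalfPlane.I
  have h3 : ModularGroup.S • UpperHalfPlane.I = UpperHalfPlane.I :=
    ModularGroup.stabilizer_I.mpr (by simp)
  have h5 : (I : ℂ) ^ (6 : ℤ) = -1 := by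
    rw [show (6 : ℤ) = ((6 : ℕ) : ℤ) by rfl, zpow_natCast, show (I : ℂ) ^ 6 = (I ^ 2) ^ 3 by ring,
      I_sq]
    norm_num
  rw [h3, ModularGroup.denom_S, coe_I, h5] at h
  linear_combination h / 2

lemma bernoulli_four_eq : bernoulli 4 = -1 / 30 := by decide +kernel

lemma bernoulli_six_eq : bernoulli 6 = 1 / 42 := by decide +kernel

lemma hasSum_rad : HasSum (fun m : ℕ =>
    504 * (ArithmeticFunction.sigma 5 (m + 1) : ℝ) * rad ^ (m + 1)) 1 := by
  have h := hasSum_cusp (k := 6) (by norm_num) ⟨3, rfl⟩ (w := (rad : ℂ))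
    (by rw [Complex.norm_real, Real.norm_of_nonneg rad_pos.le]; exact rad_lt_one)
  have h1 : cusp E₆ (rad : ℂ) = 0 := by
    have hq : (rad : ℂ) = cexp (2 * π * I * (UpperHalfPlane.I : ℍ)) := by
      rw [rad, Complex.ofReal_exp, coe_I, mul_assoc (2 * π : ℂ), I_mul_I]
      push_cast
      ring_nf
    rw [hq, cusp_q, E₆_I]
  rw [h1, bernoulli_six_eq] at h
  have h2 := h.neg
  have e1 : -((0 : ℂ) - 1) = ((1 : ℝ) : ℂ) := by push_cast; ring
  have e2 : (fun m : ℕ => -(-(2 * ((6 : ℕ) : ℂ) / ((1 / 42 : ℚ) : ℂ)) *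
      (ArithmeticFunction.sigma (6 - 1) (m + 1)) * (rad : ℂ) ^ (m + 1))) =
      fun m => ((504 * (ArithmeticFunction.sigma 5 (m + 1) : ℝ) * rad ^ (m + 1) : ℝ) : ℂ) := by
    ext m
    push_cast
    norm_num
  rw [e1, e2] at h2
  exact Complex.hasSum_ofReal.mp h2

lemma sum_lt {w : ℂ} (hw : w ∈ Metric.ball (0 : ℂ) rad) (c : ℕ → ℂ)
    (hc : ∀ m, ‖c m‖ ≤ 504 * (ArithmeticFunction.sigma 5 (m + 1) : ℝ)) {s : ℂ}
    (hs : HasSum (fun m : ℕ => c m * w ^ (m + 1)) s) : ‖s‖ < 1 := by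
  have hw' : ‖w‖ < rad := mem_ball_zero_iff.mp hw
  have hle : ∀ m, ‖c m * w ^ (m + 1)‖ ≤
      504 * (ArithmeticFunction.sigma 5 (m + 1) : ℝ) * ‖w‖ ^ (m + 1) := fun m => by
    rw [norm_mul, norm_pow]
    gcongr
    exact hc m
  have hle2 : ∀ m, 504 * (ArithmeticFunction.sigma 5 (m + 1) : ℝ) * ‖w‖ ^ (m + 1) ≤
      504 * (ArithmeticFunction.sigma 5 (m + 1) : ℝ) * rad ^ (m + 1) := fun m => by
    gcongr
  have hsum := Summable.of_nonneg_of_le (fun m => by positivity) hle2 hasSum_rad.summable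
  have h1 : ‖s‖ ≤ ∑' m : ℕ, 504 * (ArithmeticFunction.sigma 5 (m + 1) : ℝ) * ‖w‖ ^ (m + 1) :=
    hs.norm_le_of_bounded hsum.hasSum hle
  refine h1.trans_lt ?_
  rw [← hasSum_rad.tsum_eq]
  refine hsum.tsum_lt_tsum (i := 0) hle2 ?_ hasSum_rad.summable
  simpa using hw'

lemma cusp_E₆_ne_zero {w : ℂ} (hw : w ∈ Metric.ball (0 : ℂ) rad) : cusp E₆ w ≠ 0 := by
  intro h0
  have h := hasSum_cusp (k := 6) (by norm_num) ⟨3, rfl⟩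
    ((mem_ball_zero_iff.mp hw).trans rad_lt_one)
  have := sum_lt hw _ (fun m => by rw [bernoulli_six_eq, norm_mul]; norm_num) h
  rw [h0] at this
  norm_num at this

lemma cusp_E₄_ne_zero {w : ℂ} (hw : w ∈ Metric.ball (0 : ℂ) rad) : cusp E₄ w ≠ 0 := by
  intro h0
  have h := hasSum_cusp (k := 4) (by norm_num) ⟨2, rfl⟩
    ((mem_ball_zero_iff.mp hw).trans rad_lt_one)
  have := sum_lt hw _ (fun m => by
    have hσ : ArithmeticFunction.sigma 3 (m + 1) ≤ ArithmeticFunction.sigma 5 (m + 1) := by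
      rw [ArithmeticFunction.sigma_apply, ArithmeticFunction.sigma_apply]
      exact Finset.sum_le_sum fun d hd =>
        Nat.pow_le_pow_right (Nat.pos_of_mem_divisors hd) (by norm_num)
    have hσ' : (ArithmeticFunction.sigma 3 (m + 1) : ℝ) ≤ ArithmeticFunction.sigma 5 (m + 1) := by
      exact_mod_cast hσ
    rw [bernoulli_four_eq, norm_mul]
    norm_num
    nlinarith) h
  rw [h0] at this
  norm_num at this

lemma cusp_discriminant_zero : cusp discriminant 0 = 0 := by
  have h := discriminant_cuspFunction_eqOn (Metric.mem_ball_self one_pos)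
  simpa using h

/-- If `F` is, as a function of `q`, holomorphic near `|q| < exp (-2π)` and zero at `q = 0`, then
its anti-derivative is holomorphic on `Im τ > 1`, and `δ` takes it back to `F`. -/
lemma exists_antiDeriv {F : ℍ → ℂ} {c : ℂ → ℂ} (hc : DifferentiableOn ℂ c (Metric.ball 0 rad))
    (h0 : c 0 = 0) (hF : ∀ τ : ℍ, F τ = c (cexp (2 * π * I * τ))) :
    ∃ H : ℂ → ℂ, (∀ z ∈ halfPlane, HasDerivAt H (2 * π * I * F (ofComplex z)) z) ∧
      ∀ z, antiDeriv F z = H z := by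
  have hr : Metric.ball (0 : ℂ) rad ∈ nhds (0 : ℂ) := Metric.ball_mem_nhds _ rad_pos
  have hG : DifferentiableOn ℂ (dslope c 0) (Metric.ball 0 rad) :=
    (Complex.differentiableOn_dslope hr).mpr hc
  have hcG : ∀ w, c w = w * dslope c 0 w := fun w => by
    have := sub_smul_dslope c 0 w
    simpa [h0] using this.symm
  obtain ⟨g, hg0, hg⟩ := hG.isExactOn_ball.with_val_at 0 0
  refine ⟨fun z => g (cexp (2 * π * I * z)), fun z hz => ?_, fun z =>
    antiDeriv_eq hg hG.continuousOn hg0 (fun τ _ => (hF τ).trans (hcG _)) z⟩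
  have h1 : HasDerivAt (fun z => 2 * π * I * z) (2 * π * I * 1) z :=
    (hasDerivAt_id z).const_mul _
  have h2 := (hg _ (norm_q_lt hz)).comp z h1.cexp
  have hz' : 0 < z.im := zero_lt_one.trans hz
  have he : 2 * π * I * F (ofComplex z) =
      dslope c 0 (cexp (2 * π * I * z)) * (cexp (2 * π * I * z) * (2 * π * I * 1)) := by
    rw [hF, ofComplex_apply_of_im_pos hz', hcG]
    change 2 * π * I * (cexp (2 * π * I * z) * dslope c 0 (cexp (2 * π * I * z))) = _
    ring
  rw [he]
  exact h2

lemma antiDeriv_mem {F : ℍ → ℂ} (h : ∃ H : ℂ → ℂ, (∀ z ∈ halfPlane,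
    HasDerivAt H (2 * π * I * F (ofComplex z)) z) ∧ ∀ z, antiDeriv F z = H z) :
    antiDeriv F ∈ Hol := by
  obtain ⟨H, hH, he⟩ := h
  exact ⟨H, fun z hz => (hH z hz).differentiableAt.differentiableWithinAt, he⟩

lemma deltaHol_antiDeriv {F : ℍ → ℂ} (h : ∃ H : ℂ → ℂ, (∀ z ∈ halfPlane,
    HasDerivAt H (2 * π * I * F (ofComplex z)) z) ∧ ∀ z, antiDeriv F z = H z) (z : halfPlane) :
    (deltaHol ⟨antiDeriv F, antiDeriv_mem h⟩).1 z = F (pt z) := by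
  obtain ⟨H, hH, he⟩ := h
  change (2 * π * I)⁻¹ * deriv (ext (antiDeriv F)) z = F (pt z)
  rw [(ext_eventuallyEq he z).deriv_eq, (hH z z.2).deriv,
    inv_mul_cancel_left₀ Complex.two_pi_I_ne_zero,
    ofComplex_apply_of_im_pos (zero_lt_one.trans z.2)]
  rfl

lemma exists_F4a : ∃ H : ℂ → ℂ, (∀ z ∈ halfPlane,
    HasDerivAt H (2 * π * I * F4a (ofComplex z)) z) ∧ ∀ z, antiDeriv F4a z = H z :=
  exists_antiDeriv (c := fun w => cusp discriminant w / cusp E₄ w ^ 2)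
    ((differentiableOn_cusp CuspForm.discriminant).div ((differentiableOn_cusp E₄).pow 2)
      fun _ hw => pow_ne_zero _ (cusp_E₄_ne_zero hw))
    (by simp [cusp_discriminant_zero])
    fun τ => by simp only [cusp_q, cusp_q_discriminant, F4a]

lemma exists_F4b : ∃ H : ℂ → ℂ, (∀ z ∈ halfPlane,
    HasDerivAt H (2 * π * I * F4b (ofComplex z)) z) ∧ ∀ z, antiDeriv F4b z = H z :=
  exists_antiDeriv (c := fun w => cusp E₄ w * cusp discriminant w / cusp E₆ w ^ 2)
    (((differentiableOn_cusp E₄).mul (differentiableOn_cusp CuspForm.discriminant)).div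
      ((differentiableOn_cusp E₆).pow 2) fun _ hw => pow_ne_zero _ (cusp_E₆_ne_zero hw))
    (by simp [cusp_discriminant_zero])
    fun τ => by simp only [cusp_q, cusp_q_discriminant, F4b]

lemma exists_F6 : ∃ H : ℂ → ℂ, (∀ z ∈ halfPlane,
    HasDerivAt H (2 * π * I * F6 (ofComplex z)) z) ∧ ∀ z, antiDeriv F6 z = H z :=
  exists_antiDeriv (c := fun w => cusp E₆ w * cusp discriminant w / cusp E₄ w ^ 3)
    (((differentiableOn_cusp E₆).mul (differentiableOn_cusp CuspForm.discriminant)).div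
      ((differentiableOn_cusp E₄).pow 3) fun _ hw => pow_ne_zero _ (cusp_E₄_ne_zero hw))
    (by simp [cusp_discriminant_zero])
    fun τ => by simp only [cusp_q, cusp_q_discriminant, F6]

end Level1

/-- The function `τ`. -/
def tauHol : Hol := ⟨fun z => z, id, differentiableOn_id, fun _ => rfl⟩

/-- The function `q = exp (2πiτ)`. -/
def qHol : Hol := ⟨fun z => cexp (2 * π * I * z), fun z => cexp (2 * π * I * z),
  ((differentiable_id.const_mul _).cexp).differentiableOn, fun _ => rfl⟩

/-- The Eisenstein series `E₂`. -/
def E2Hol : Hol := restrict EisensteinSeries.E2 E2_mdifferentiable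

/-- The Eisenstein series `E₄`. -/
def E4Hol : Hol := restrict ModularForm.E₄ (ModularFormClass.holo ModularForm.E₄)

/-- The Eisenstein series `E₆`. -/
def E6Hol : Hol := restrict ModularForm.E₆ (ModularFormClass.holo ModularForm.E₆)

/-- The anti-derivative `δ⁻¹ F_{4a}`. -/
def antiF4a : Hol := ⟨antiDeriv F4a, antiDeriv_mem exists_F4a⟩

/-- The anti-derivative `δ⁻¹ F_{4b}`. -/
def antiF4b : Hol := ⟨antiDeriv F4b, antiDeriv_mem exists_F4b⟩

/-- The anti-derivative `δ⁻¹ F₆`. -/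
def antiF6 : Hol := ⟨antiDeriv F6, antiDeriv_mem exists_F6⟩

lemma deltaHol_antiF4a (z : halfPlane) : (deltaHol antiF4a).1 z = F4a (pt z) :=
  deltaHol_antiDeriv exists_F4a z

lemma deltaHol_antiF4b (z : halfPlane) : (deltaHol antiF4b).1 z = F4b (pt z) :=
  deltaHol_antiDeriv exists_F4b z

lemma deltaHol_antiF6 (z : halfPlane) : (deltaHol antiF6).1 z = F6 (pt z) :=
  deltaHol_antiDeriv exists_F6 z

end MagneticForms

end

open MagneticForms

/-! By Ramanujan's identities δ maps E₂, E₄, E₆ to polynomials in themselves, and δ of each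
antiderivative is a rational function of E₄ and E₆. So the eight functions already generate the
differential field as a field, and the claim is that they are algebraically independent.

The proof splits along the field `GlobalMer` of quotients of functions holomorphic on all of ℍ. It
contains τ, q, E₂, E₄, E₆, and these five are independent over ℂ (`eq_zero_of_eval_eq_zero`,
`algebraicIndependent_base`): a relation may be transported by SL₂(ℤ), under which the five
functions change in different ways, and the resulting identities, valid at infinitely many or at
accumulating points, free one variable after another.

The antiderivatives are independent over `GlobalMer`. By Ostrowski's theorem
(`algebraicIndependent_of_antiderivatives`) it suffices that no nontrivial constant combination of
them lies in `GlobalMer`. If one did, c₁F₄ₐ + c₂F₄b + c₃F₆ would be, up to the factor 2πi, the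
derivative of a meromorphic function on ℍ and would have no residues, even at the zeros of E₄ and
E₆, which lie outside Im τ > 1. Up to nonzero factors the residue at i is c₂E₂(i), with E₂(i) ≠ 0,
and the residue at a zero of E₄ is E₂(4c₁ − 3c₃E₂). As E₂ is not modular, it takes nonzero values e
and 3e at two zeros of E₄, which forces c₁ = c₃ = 0 (`residue_E₆`, `residue_E₄`, `exists_zeros_E₄`,
`combination_eq_zero`). -/

noncomputable section

namespace MagneticForms

/-! ### Ostrowski's theorem on algebraic independence of antiderivatives. -/

section Ostrowski

open MvPolynomial

variable {σ R : Type*} [CommRing R]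

/-- Applying an additive map to all the coefficients of a polynomial. -/
def mapCoeff (f : R →+ R) (p : MvPolynomial σ R) : MvPolynomial σ R :=
  ∑ m ∈ p.support, monomial m (f (coeff m p))

lemma coeff_mapCoeff (f : R →+ R) (p : MvPolynomial σ R) (m : σ →₀ ℕ) :
    coeff m (mapCoeff f p) = f (coeff m p) := by
  classical
  rw [mapCoeff, coeff_sum]
  simp only [coeff_monomial, Finset.sum_ite_eq', mem_support_iff]
  split_ifs with h
  · rfl
  · rw [not_not.mp h, map_zero]

lemma mapCoeff_add (f : R →+ R) (p q : MvPolynomial σ R) :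
    mapCoeff f (p + q) = mapCoeff f p + mapCoeff f q := by
  ext m
  simp [coeff_mapCoeff]

lemma mapCoeff_C (f : R →+ R) (a : R) : mapCoeff f (C a : MvPolynomial σ R) = C (f a) := by
  classical
  ext m
  rw [coeff_mapCoeff, coeff_C, coeff_C]
  split_ifs <;> simp

lemma mapCoeff_mul_X (f : R →+ R) (p : MvPolynomial σ R) (i : σ) :
    mapCoeff f (p * X i) = mapCoeff f p * X i := by
  classical
  ext m
  rw [coeff_mapCoeff, coeff_mul_X', coeff_mul_X', coeff_mapCoeff]
  split_ifs <;> simp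

variable {k K : Type*} [Field k] [Field K] [Algebra k K]

/-- The restriction of a derivation to a stable intermediate field, as an additive map. -/
def restrictDeriv (D : Derivation k K K) (L : IntermediateField k K) (hL : ∀ x ∈ L, D x ∈ L) :
    L →+ L where
  toFun x := ⟨D x, hL x x.2⟩
  map_zero' := by ext; simp
  map_add' x y := by ext; simp

variable [Fintype σ]

/-- The total derivative of a polynomial over `L` in functions whose derivatives are `v`. -/
def totalDeriv (d : R →+ R) (v : σ → R) (p : MvPolynomial σ R) : MvPolynomial σ R :=
  mapCoeff d p + ∑ i, C (v i) * pderiv i p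

lemma coeff_totalDeriv (d : R →+ R) (v : σ → R) (p : MvPolynomial σ R) (m : σ →₀ ℕ) :
    coeff m (totalDeriv d v p) =
      d (coeff m p) + ∑ i, v i * (coeff (m + Finsupp.single i 1) p * (m i + 1)) := by
  simp [totalDeriv, coeff_mapCoeff, coeff_sum, coeff_pderiv]

/-- The chain rule. Because the derivatives of the `y i` lie in `L`, a polynomial relation over `L`
differentiates to another one over `L`. -/
lemma derivation_aeval (D : Derivation k K K) (L : IntermediateField k K)
    (hL : ∀ x ∈ L, D x ∈ L) (y : σ → K) (v : σ → L) (hv : ∀ i, D (y i) = v i)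
    (p : MvPolynomial σ L) :
    D (aeval y p) = aeval y (totalDeriv (restrictDeriv D L hL) v p) := by
  induction p using MvPolynomial.induction_on with
  | C a =>
    simp only [totalDeriv, mapCoeff_C, pderiv_C, mul_zero, Finset.sum_const_zero, add_zero, aeval_C]
    rfl
  | add p q hp hq =>
    simp only [map_add, hp, hq, totalDeriv, mapCoeff_add, mul_add, Finset.sum_add_distrib]
    ring
  | mul_X p i hp =>
    classical
    have h1 : totalDeriv (restrictDeriv D L hL) v (p * X i) =
        totalDeriv (restrictDeriv D L hL) v p * X i + C (v i) * p := by
      simp only [totalDeriv, mapCoeff_mul_X, Derivation.leibniz, pderiv_X, smul_eq_mul, mul_add,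
        Finset.sum_add_distrib, add_mul, Finset.sum_mul]
      rw [Finset.sum_eq_single i (fun j _ hj => by simp [hj.symm]) (by simp)]
      simp only [Pi.single_eq_same, mul_one]
      rw [add_assoc, add_comm (C (v i) * p)]
      congr 2
      exact Finset.sum_congr rfl fun j _ => by ring
    rw [h1]
    simp only [map_mul, map_add, aeval_X, aeval_C, Derivation.leibniz, hp, hv, smul_eq_mul]
    change _ = _ + (v i : K) * _
    ring

/-- Ostrowski's theorem: antiderivatives of elements of a differential field `L` are algebraically
independent over `L` as soon as no nontrivial combination of them with constant coefficients lies
in `L`, provided that there are no new constants. -/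
theorem algebraicIndependent_of_antiderivatives [CharZero k] (D : Derivation k K K)
    (L : IntermediateField k K) (hL : ∀ x ∈ L, D x ∈ L)
    (hconst : ∀ x, D x = 0 → ∃ c : k, x = algebraMap k K c) (y : σ → K) (hy : ∀ i, D (y i) ∈ L)
    (hcomb : ∀ c : σ → k, ∑ i, algebraMap k K (c i) * y i ∈ L → c = 0) :
    AlgebraicIndependent L y := by
  classical
  have : CharZero L := charZero_of_injective_algebraMap (algebraMap k L).injective
  by_contra hdep
  rw [algebraicIndependent_iff] at hdep
  push Not at hdep
  let v : σ → L := fun i => ⟨D (y i), hy i⟩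
  let d := restrictDeriv D L hL
  let top : MvPolynomial σ L → Finset (σ →₀ ℕ) := fun p =>
    p.support.filter fun m => m.degree = p.totalDegree
  obtain ⟨p₀, hp₀, hp₀'⟩ := hdep
  let S : Set (MvPolynomial σ L) := {p | aeval y p = 0 ∧ p ≠ 0}
  -- A minimal relation is taken for the lexicographic order on total degree, then number of
  -- monomials of top degree.
  let μ : MvPolynomial σ L → ℕ ×ₗ ℕ := fun p => toLex (p.totalDegree, (top p).card)
  obtain ⟨p, ⟨hp, hp'⟩, hmin⟩ : ∃ p ∈ S, ∀ q ∈ S, ¬ μ q < μ p := by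
    obtain ⟨p, hp, h⟩ := (InvImage.wf μ wellFounded_lt).has_min S ⟨p₀, hp₀, hp₀'⟩
    exact ⟨p, hp, h⟩
  obtain ⟨m₀, hm₀, hdeg⟩ : ∃ m ∈ p.support, m.degree = p.totalDegree := by
    obtain ⟨m, hm, h⟩ := Finset.exists_mem_eq_sup p.support
      (support_nonempty.mpr hp') (fun m => m.degree)
    refine ⟨m, hm, ?_⟩
    rw [← h, totalDegree]
    rfl
  have hle : ∀ (q : MvPolynomial σ L) (m : σ →₀ ℕ), q.totalDegree < m.degree → coeff m q = 0 :=
    fun q m h => by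
      by_contra hne
      exact absurd (le_totalDegree (mem_support_iff.mpr hne)) (not_le.mpr h)
  set a : L := coeff m₀ p with ha
  have ha0 : a ≠ 0 := mem_support_iff.mp hm₀
  -- Once a top coefficient is 1 its derivative is 0, so the differentiated relation `q` has lost a
  -- top monomial; minimality then leaves only `q = 0`.
  set r : MvPolynomial σ L := C a⁻¹ * p with hr
  have hrc : ∀ m, coeff m r = a⁻¹ * coeff m p := fun m => coeff_C_mul m _ _
  have hr1 : coeff m₀ r = 1 := by rw [hrc, inv_mul_cancel₀ ha0]
  have hr0 : aeval y r = 0 := by simp [hr, hp]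
  have hrle : ∀ m : σ →₀ ℕ, p.totalDegree < m.degree → coeff m r = 0 := fun m h => by
    rw [hrc, hle p m h, mul_zero]
  set q := totalDeriv d v r with hq
  have hq0 : aeval y q = 0 := by
    rw [hq, ← derivation_aeval D L hL y v (fun _ => rfl), hr0, map_zero]
  -- The terms `D (y i) * ∂ᵢ` lower the degree, so in top degree only the differentiated
  -- coefficients survive.
  have hqtop : ∀ m : σ →₀ ℕ, p.totalDegree ≤ m.degree → coeff m q = d (coeff m r) := fun m h => by
    rw [hq, coeff_totalDeriv, Finset.sum_eq_zero, add_zero]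
    intro i _
    rw [hrle, zero_mul, mul_zero]
    simp only [map_add, Finsupp.degree_single]
    omega
  have hqz : q = 0 := by
    by_contra hne
    have hqdeg : q.totalDegree ≤ p.totalDegree := by
      refine Finset.sup_le fun m hm => ?_
      by_contra h
      have h' : p.totalDegree < m.degree := not_le.mp h
      rw [mem_support_iff, hqtop m h'.le, hrle m h', map_zero] at hm
      exact hm rfl
    refine hmin q ⟨hq0, hne⟩ ?_
    rw [Prod.Lex.toLex_lt_toLex]
    rcases hqdeg.lt_or_eq with h | h
    · exact Or.inl h
    · refine Or.inr ⟨h, Finset.card_lt_card (Finset.ssubset_iff_of_subset ?_ |>.mpr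
        ⟨m₀, Finset.mem_filter.mpr ⟨hm₀, hdeg⟩, ?_⟩)⟩
      · intro m hm
        rw [Finset.mem_filter, mem_support_iff] at hm ⊢
        have hm2 : m.degree = p.totalDegree := hm.2.trans h
        refine ⟨fun h0 => hm.1 ?_, hm2⟩
        rw [hqtop m hm2.ge, hrc, h0, mul_zero, map_zero]
      · rw [Finset.mem_filter, mem_support_iff, hqtop m₀ hdeg.ge, hr1]
        refine fun h => h.1 (Subtype.ext ?_)
        exact D.map_one_eq_zero
  have hconst' : ∀ m : σ →₀ ℕ, m.degree = p.totalDegree →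
      ∃ c : k, ((coeff m r : L) : K) = algebraMap k K c := fun m hm => by
    refine hconst _ ?_
    have := hqtop m hm.ge
    rw [hqz, coeff_zero] at this
    exact (congrArg Subtype.val this).symm
  obtain ⟨i₀, hi₀⟩ : ∃ i, m₀ i ≠ 0 := by
    by_contra! h
    have hm : m₀ = 0 := Finsupp.ext h
    have hpC : p = C a := by
      rw [ha, hm]
      exact totalDegree_eq_zero_iff_eq_C.mp (by rw [← hdeg, hm]; simp)
    rw [hpC, aeval_C] at hp
    exact ha0 ((map_eq_zero _).mp hp)
  -- One degree below the top, the vanishing of `q` at `m` says that `coeff m r` plus a constant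
  -- combination of the `y i` has derivative 0. That combination therefore lies in `L`, yet its
  -- coefficient at `i₀` is a nonzero integer times `coeff m₀ r = 1`.
  set m := m₀ - Finsupp.single i₀ 1 with hm
  have hmi : m + Finsupp.single i₀ 1 = m₀ := by
    refine tsub_add_cancel_of_le ?_
    rw [Finsupp.single_le_iff]
    omega
  have hmdeg : ∀ i, (m + Finsupp.single i 1).degree = p.totalDegree := fun i => by
    rw [← hdeg, ← hmi]
    simp
  choose c hc using fun i => hconst' _ (hmdeg i)
  have hD : D ((coeff m r : L) + ∑ i, algebraMap k K (c i * (m i + 1)) * y i) = 0 := by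
    have := congrArg (fun z : L => (z : K)) (coeff_totalDeriv d v r m)
    rw [← hq, hqz, coeff_zero] at this
    simp only [map_add, map_sum, Derivation.leibniz, Derivation.map_algebraMap,
      smul_eq_mul]
    refine Eq.trans ?_ this.symm
    push_cast
    congr 1
    refine Finset.sum_congr rfl fun i _ => ?_
    rw [hc i]
    change algebraMap k K (c i) * _ * _ + _ = D (y i) * _
    ring
  obtain ⟨e, he⟩ := hconst _ hD
  have hz := hcomb (fun i => c i * (m i + 1)) (by
    have : ∑ i, algebraMap k K (c i * (m i + 1)) * y i = algebraMap k K e - (coeff m r : L) := by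
      rw [← he]; ring
    rw [this]
    exact L.sub_mem (L.algebraMap_mem e) (coeff m r).2)
  have h0 := congrFun hz i₀
  simp only [Pi.zero_apply, mul_eq_zero] at h0
  rcases h0 with h0 | h0
  · have := hc i₀
    rw [hmi, hr1, h0, map_zero] at this
    simp at this
  · exact Nat.cast_add_one_ne_zero _ h0

end Ostrowski

open Complex
open UpperHalfPlane hiding I
open scoped Real Manifold

/-! ### Ramanujan's identities for the derivatives of E₂, E₄, E₆. -/

section Ramanujan

open ModularForm MatrixGroups EisensteinSeries Derivative Filter Topology

/-- In the coordinate q the operator is q d/dq, and f is holomorphic at q = 0; the factor q kills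
the limit. -/
lemma tendsto_D_atImInfty {f : ℍ → ℂ} (hper : Function.Periodic (f ∘ ofComplex) 1) (hf : MDiff f)
    (hb : IsBoundedAtImInfty f) : Tendsto (D f) atImInfty (𝓝 0) := by
  have hper' : Function.Periodic (f ∘ ofComplex) (1 : ℝ) := by simpa using hper
  have hA : AnalyticAt ℂ (cusp f) 0 := analyticAt_cuspFunction_zero one_pos hper' hf hb
  have hq : Tendsto (fun τ : ℍ => Function.Periodic.qParam 1 τ) atImInfty (𝓝 0) :=
    qParam_tendsto_atImInfty one_pos
  have hD : D f = fun τ : ℍ => Function.Periodic.qParam 1 τ *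
      deriv (cusp f) (Function.Periodic.qParam 1 τ) := by
    ext τ
    have h1 : f ∘ ofComplex = fun z => cusp f (cexp (2 * π * I * z)) := by
      ext z
      rw [← qParam_eq]
      exact (Function.Periodic.eq_cuspFunction one_ne_zero hper' z).symm
    have hd : DifferentiableAt ℂ (cusp f) (cexp (2 * π * I * τ)) := by
      rw [← qParam_eq]
      exact differentiableAt_cuspFunction one_pos hper' hf hb
        (Function.Periodic.norm_qParam_lt_one one_pos τ.2)
    have h2 : HasDerivAt (fun z => 2 * π * I * z) (2 * π * I * 1) (τ : ℂ) :=
      (hasDerivAt_id _).const_mul _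
    have h3 := hd.hasDerivAt.comp (τ : ℂ) h2.cexp
    rw [normalizedDerivOfComplex, h1, qParam_eq]
    refine (congrArg _ h3.deriv).trans ?_
    field_simp [Complex.two_pi_I_ne_zero]
  rw [hD]
  simpa using hq.mul (hA.deriv.continuousAt.tendsto.comp hq)

lemma periodic_of_slash_T {k : ℤ} {f : ℍ → ℂ} (h : f ∣[k] ModularGroup.T = f) :
    Function.Periodic (f ∘ ofComplex) 1 := by
  intro w
  by_cases hw : 0 < w.im
  · have hw' : 0 < (w + 1).im := by simpa using hw
    have h1 := congrFun h ⟨w, hw⟩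
    have hd : denom ModularGroup.T (⟨w, hw⟩ : ℍ) = 1 := by
      rw [ModularGroup.denom_apply]
      simp [ModularGroup.T]
    rw [SL_slash_apply, hd, one_zpow, mul_one, modular_T_smul] at h1
    simp only [Function.comp_apply, ofComplex_apply_of_im_pos hw, ofComplex_apply_of_im_pos hw']
    rw [← h1]
    congr 1
    ext
    simp [add_comm]
  -- Off the upper half plane `ofComplex` has one fixed default value, so periodicity is automatic
  -- there.
  · have hw' : (w + 1).im ≤ 0 := by simpa using hw
    simp only [Function.comp_apply, ofComplex_apply_of_im_nonpos hw',
      ofComplex_apply_of_im_nonpos (not_lt.mp hw)]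

lemma E2_slash_T : E2 ∣[(2 : ℤ)] ModularGroup.T = E2 := by
  rw [E2_slash_action, D2_T, smul_zero, sub_zero]

lemma tendsto_E2 : Tendsto E2 atImInfty (𝓝 1) := by
  have hA : AnalyticAt ℂ (cusp E2) 0 := analyticAt_cuspFunction_zero one_pos
    (by simpa using periodic_of_slash_T E2_slash_T) E2_mdifferentiable isBoundedAtImInfty_E2
  have hs : ∀ τ : ℍ, HasSum (fun m : ℕ ↦ (if m = 0 then 1 else -24 * ArithmeticFunction.sigma 1 m :
      ℂ) • Function.Periodic.qParam 1 τ ^ m) (E2 τ) := fun τ => by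
    simpa only [Function.Periodic.qParam, ofReal_one, div_one] using hasSum_qExpansion_E2 (z := τ)
  have h1 : cusp E2 0 = 1 := by
    have := (hasFPowerSeriesOnBall_cuspFunction one_pos hA hs).coeff_zero ![]
    simpa using this.symm
  have := hA.continuousAt.tendsto.comp (qParam_tendsto_atImInfty one_pos)
  rw [h1] at this
  refine this.congr fun τ => ?_
  exact eq_cuspFunction τ one_ne_zero (by simpa using periodic_of_slash_T E2_slash_T)

lemma tendsto_E {k : ℕ} (hk : 3 ≤ k) (hk2 : Even k) : Tendsto (E hk) atImInfty (𝓝 1) := by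
  have h0 : cusp (E hk) 0 = 1 := by
    have h := hasSum_cusp hk hk2 (w := 0) (by simp)
    simp only [ne_eq, Nat.add_eq_zero_iff, one_ne_zero, and_false, not_false_eq_true, zero_pow,
      mul_zero] at h
    exact sub_eq_zero.mp (h.unique hasSum_zero)
  have hc : ContinuousAt (cusp (E hk)) 0 :=
    (ModularFormClass.analyticAt_cuspFunction_zero (E hk) one_pos
      one_mem_strictPeriods_SL).continuousAt
  have := hc.tendsto.comp (qParam_tendsto_atImInfty one_pos)
  rw [h0] at this
  refine this.congr fun τ => ?_
  exact SlashInvariantFormClass.eq_cuspFunction (E hk) τ one_mem_strictPeriods_SL one_ne_zero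

/-- A level one modular form from a holomorphic slash-invariant function bounded at infinity. -/
def mkLevelOne (k : ℤ) (f : ℍ → ℂ) (hf : MDiff f) (h : ∀ γ : SL(2, ℤ), f ∣[k] γ = f)
    (hb : IsBoundedAtImInfty f) : ModularForm 𝒮ℒ k where
  toFun := f
  slash_action_eq' A hA := by
    obtain ⟨A, rfl⟩ := hA
    exact h A
  holo' := hf
  bdd_at_cusps' hc := by
    rw [Subgroup.IsArithmetic.isCusp_iff_isCusp_SL2Z] at hc
    rw [OnePoint.isBoundedAt_iff_forall_SL2Z hc]
    intro γ _
    rw [h]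
    exact hb

/-- In a one-dimensional space of forms the constant term decides everything; the identities below
are read off from limits at i∞. -/
lemma eq_mul_of_rank_one {k : ℤ} (hr : Module.rank ℂ (ModularForm 𝒮ℒ k) = 1)
    (g : ModularForm 𝒮ℒ k) (hg : Tendsto g atImInfty (𝓝 1)) {f : ℍ → ℂ} (hf : MDiff f)
    (h : ∀ γ : SL(2, ℤ), f ∣[k] γ = f) {c : ℂ} (hc : Tendsto f atImInfty (𝓝 c)) (z : ℍ) :
    f z = c * g z := by
  have hb : IsBoundedAtImInfty f := hc.isBigO_one ℝ
  have hg0 : g ≠ 0 := by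
    rintro rfl
    exact zero_ne_one (tendsto_nhds_unique tendsto_const_nhds hg)
  obtain ⟨a, ha⟩ := (finrank_eq_one_iff_of_nonzero' g hg0).mp
    (Module.rank_eq_one_iff_finrank_eq_one.mp hr) (mkLevelOne k f hf h hb)
  have ha' : ∀ z, a * g z = f z := fun z => congrArg (fun F : ModularForm 𝒮ℒ k => F z) ha
  have : c = a := by
    refine tendsto_nhds_unique hc ?_
    have := hg.const_mul a
    rw [mul_one] at this
    exact this.congr ha'
  rw [this, ha']

lemma slash_E {k : ℕ} (hk : 3 ≤ k) (γ : SL(2, ℤ)) : (E hk : ℍ → ℂ) ∣[(k : ℤ)] γ = E hk :=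
  SlashInvariantForm.slash_action_eqn (E hk) _ ⟨γ, rfl⟩

/-- The Serre derivative of E₄ has weight 6 and constant term −4/12, hence is −E₆/3. -/
lemma D_E₄ (z : ℍ) : D E₄ z = (E2 z * E₄ z - E₆ z) / 3 := by
  have h4 := tendsto_E (k := 4) (by norm_num) ⟨2, rfl⟩
  have hm : MDiff E₄ := ModularFormClass.holo E₄
  have hs := slash_E (k := 4) (by norm_num)
  have hD := tendsto_D_atImInfty (periodic_of_slash_T (hs ModularGroup.T)) hm (h4.isBigO_one ℝ)
  have ht : Tendsto (serreDerivative ((4 : ℤ) : ℂ) E₄) atImInfty (𝓝 (-1 / 3)) := by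
    have := hD.sub ((tendsto_E2.const_mul (((4 : ℤ) : ℂ) * 12⁻¹)).mul h4)
    norm_num at this
    norm_num
    exact this
  have := eq_mul_of_rank_one levelOne_weight_six_rank_one E₆ (tendsto_E (by norm_num) ⟨3, rfl⟩)
    (serreDerivative_mdifferentiable _ hm) (fun γ => serreDerivative_slash_invariant hm (hs γ)) ht z
  rw [serreDerivative_apply] at this
  push_cast at this
  linear_combination this

lemma rank_weight_eight : Module.rank ℂ (ModularForm 𝒮ℒ 8) = 1 := by
  have h : Module.rank ℂ (ModularForm 𝒮ℒ ((8 : ℕ) : ℤ)) = 1 := by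
    rw [dimension_level_one 8 ⟨4, rfl⟩, if_neg (by decide)]
    norm_num
  exact h

lemma exists_weight_eight : ∃ g : ModularForm 𝒮ℒ 8, ∀ z, g z = E₄ z * E₄ z :=
  ⟨ModularForm.mcast (by norm_num) (E₄.mul E₄), fun z => by
    rw [ModularForm.coe_mcast, ModularForm.coe_mul, Pi.mul_apply]⟩

/-- The Serre derivative of E₆ has weight 8 and constant term −6/12; weight 8 is spanned by E₄². -/
lemma D_E₆ (z : ℍ) : D E₆ z = (E2 z * E₆ z - E₄ z ^ 2) / 2 := by
  have h4 := tendsto_E (k := 4) (by norm_num) ⟨2, rfl⟩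
  have h6 := tendsto_E (k := 6) (by norm_num) ⟨3, rfl⟩
  have hm : MDiff E₆ := ModularFormClass.holo E₆
  have hs := slash_E (k := 6) (by norm_num)
  have hD := tendsto_D_atImInfty (periodic_of_slash_T (hs ModularGroup.T)) hm (h6.isBigO_one ℝ)
  have ht : Tendsto (serreDerivative ((6 : ℤ) : ℂ) E₆) atImInfty (𝓝 (-1 / 2)) := by
    have := hD.sub ((tendsto_E2.const_mul (((6 : ℤ) : ℂ) * 12⁻¹)).mul h6)
    norm_num at this
    norm_num
    exact this
  have h8 : Tendsto (fun τ => E₄ τ * E₄ τ) atImInfty (𝓝 1) := by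
    have := h4.mul h4
    rwa [mul_one] at this
  obtain ⟨g, hg⟩ := exists_weight_eight
  have := eq_mul_of_rank_one rank_weight_eight g (h8.congr fun z => (hg z).symm)
    (serreDerivative_mdifferentiable _ hm) (fun γ => serreDerivative_slash_invariant hm (hs γ)) ht z
  rw [serreDerivative_apply, hg] at this
  push_cast at this
  linear_combination this

lemma E2_slash_apply (γ : SL(2, ℤ)) (z : ℍ) : (E2 ∣[(2 : ℤ)] γ) z =
    E2 z + 12 * (2 * π * I)⁻¹ * ((γ 1 0 : ℂ) / denom γ z) := by
  rw [E2_slash_action]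
  have hπ : (π : ℂ) ≠ 0 := ofReal_ne_zero.mpr Real.pi_ne_zero
  simp only [Pi.sub_apply, Pi.smul_apply, smul_eq_mul, D2, riemannZeta_two]
  have := denom_ne_zero γ z
  field_simp
  linear_combination (-12 * (γ 1 0 : ℂ)) * I_sq

lemma E2_smul (γ : SL(2, ℤ)) (z : ℍ) : E2 (γ • z) =
    denom γ z ^ 2 * E2 z + 12 * (2 * π * I)⁻¹ * (γ 1 0 : ℂ) * denom γ z := by
  have h := E2_slash_apply γ z
  have hd := denom_ne_zero γ z
  rw [SL_slash_apply, zpow_neg] at h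
  have h2 : E2 (γ • z) = (E2 z + 12 * (2 * π * I)⁻¹ * ((γ 1 0 : ℂ) / denom γ z)) *
      denom γ z ^ (2 : ℤ) := by
    rw [← h, inv_mul_cancel_right₀ (zpow_ne_zero _ hd)]
  rw [h2, zpow_ofNat]
  field_simp

lemma D_div_denom (γ : SL(2, ℤ)) (z : ℍ) :
    D (fun z : ℍ => (γ 1 0 : ℂ) / denom γ z) z =
      -(2 * π * I)⁻¹ * ((γ 1 0 : ℂ) / denom γ z) ^ 2 := by
  have hd := denom_ne_zero γ z
  rw [ModularGroup.denom_apply] at hd ⊢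
  have h1 : HasDerivAt (fun w : ℂ => (γ 1 0 : ℂ) * w + (γ 1 1 : ℂ)) ((γ 1 0 : ℂ) * 1) z :=
    ((hasDerivAt_id _).const_mul _).add_const _
  have h2 := (h1.inv hd).const_mul (γ 1 0 : ℂ)
  have h3 : (fun z : ℍ => (γ 1 0 : ℂ) / denom γ z) ∘ ofComplex =ᶠ[𝓝 (z : ℂ)]
      fun w => (γ 1 0 : ℂ) * ((γ 1 0 : ℂ) * w + (γ 1 1 : ℂ))⁻¹ := by
    filter_upwards [isOpen_upperHalfPlaneSet.mem_nhds z.2] with w hw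
    rw [Function.comp_apply, ModularGroup.denom_apply, ofComplex_apply_of_im_pos hw, div_eq_mul_inv]
  rw [normalizedDerivOfComplex, h3.deriv_eq]
  refine (congrArg _ h2.deriv).trans ?_
  field_simp

lemma mdifferentiable_div_denom (γ : SL(2, ℤ)) :
    MDiff (fun z : ℍ => (γ 1 0 : ℂ) / denom γ z) := by
  rw [UpperHalfPlane.mdifferentiable_iff]
  intro z hz
  have hd := denom_ne_zero γ (⟨z, hz⟩ : ℍ)
  rw [ModularGroup.denom_apply] at hd
  refine DifferentiableAt.differentiableWithinAt ?_
  have h3 : (fun z : ℍ => (γ 1 0 : ℂ) / denom γ z) ∘ ofComplex =ᶠ[𝓝 (z : ℂ)]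
      fun w => (γ 1 0 : ℂ) / ((γ 1 0 : ℂ) * w + (γ 1 1 : ℂ)) := by
    filter_upwards [isOpen_upperHalfPlaneSet.mem_nhds hz] with w hw
    rw [Function.comp_apply, ModularGroup.denom_apply, ofComplex_apply_of_im_pos hw]
  rw [h3.differentiableAt_iff]
  exact (differentiableAt_const _).div
    ((differentiableAt_id.const_mul _).add_const _) hd

/-- The parameter is 1, not the weight 2: with this choice the terms in c/(cz + d) produced by D E₂
and by E₂²/12 cancel exactly. -/
lemma serreDerivative_E2_slash (γ : SL(2, ℤ)) :
    serreDerivative 1 E2 ∣[(4 : ℤ)] γ = serreDerivative 1 E2 := by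
  ext z
  have h1 : E2 ∣[(2 : ℤ)] γ =
      E2 + (12 * (2 * π * I)⁻¹ : ℂ) • fun z : ℍ => (γ 1 0 : ℂ) / denom γ z := by
    ext z
    rw [E2_slash_apply]
    rfl
  have h2 := congrFun (normalizedDerivOfComplex_SL_slash (k := 2) E2_mdifferentiable (γ := γ)) z
  rw [h1, normalizedDerivOfComplex_add _ _ E2_mdifferentiable
    ((mdifferentiable_div_denom γ).const_smul _),
    normalizedDerivOfComplex_smul _ _ (mdifferentiable_div_denom γ)] at h2
  simp only [Pi.add_apply, Pi.smul_apply, Pi.sub_apply, smul_eq_mul, D_div_denom] at h2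
  have h3 := congrFun (ModularForm.mul_slash_SL2 2 2 γ E2 E2) z
  rw [Pi.mul_apply, E2_slash_apply] at h3
  have h4 : serreDerivative 1 E2 = D E2 + (-12⁻¹ : ℂ) • (E2 * E2) := by
    ext w
    simp only [serreDerivative_apply, Pi.add_apply, Pi.smul_apply, Pi.mul_apply, smul_eq_mul]
    ring
  rw [h4, SlashAction.add_slash, SL_smul_slash]
  norm_num at h2 h3
  simp only [Pi.add_apply, Pi.smul_apply, Pi.mul_apply, smul_eq_mul, h3]
  linear_combination -h2

lemma D_E2 (z : ℍ) : D E2 z = (E2 z ^ 2 - E₄ z) / 12 := by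
  have hD := tendsto_D_atImInfty (periodic_of_slash_T E2_slash_T) E2_mdifferentiable
    isBoundedAtImInfty_E2
  have ht : Tendsto (serreDerivative 1 E2) atImInfty (𝓝 (-1 / 12)) := by
    have := hD.sub ((tendsto_E2.const_mul ((1 : ℂ) * 12⁻¹)).mul tendsto_E2)
    norm_num at this
    norm_num
    exact this
  have := eq_mul_of_rank_one levelOne_weight_four_rank_one E₄ (tendsto_E (by norm_num) ⟨2, rfl⟩)
    (serreDerivative_mdifferentiable _ E2_mdifferentiable) serreDerivative_E2_slash ht z
  rw [serreDerivative_apply] at this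
  linear_combination this

end Ramanujan

/-! ### The identity theorem on ℍ, and E₂ at the elliptic points. -/

section UpperHalfPlaneFunctions

open ModularForm MatrixGroups EisensteinSeries Derivative Filter Topology

lemma isPreconnected_upperHalfPlaneSet : IsPreconnected upperHalfPlaneSet :=
  (convex_halfSpace_im_gt 0).isPreconnected

lemma analyticOnNhd_comp_ofComplex {f : ℍ → ℂ} (hf : MDiff f) :
    AnalyticOnNhd ℂ (f ∘ ofComplex) upperHalfPlaneSet :=
  (UpperHalfPlane.mdifferentiable_iff.mp hf).analyticOnNhd isOpen_upperHalfPlaneSet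

lemma analyticAt_comp_ofComplex {f : ℍ → ℂ} (hf : MDiff f) (z : ℍ) :
    AnalyticAt ℂ (f ∘ ofComplex) z := analyticOnNhd_comp_ofComplex hf z z.2

lemma comp_ofComplex_coe (f : ℍ → ℂ) (z : ℍ) : (f ∘ ofComplex) z = f z := by
  rw [Function.comp_apply, ofComplex_apply]

lemma hasDerivAt_comp_ofComplex {f : ℍ → ℂ} (hf : MDiff f) (z : ℍ) :
    HasDerivAt (f ∘ ofComplex) (2 * π * I * D f z) z := by
  have h := (UpperHalfPlane.mdifferentiableAt_iff.mp (hf z)).hasDerivAt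
  rwa [normalizedDerivOfComplex, mul_inv_cancel_left₀ Complex.two_pi_I_ne_zero]

lemma eq_zero_of_frequently_comp {f : ℍ → ℂ} (hf : MDiff f) (z : ℍ)
    (h : ∃ᶠ w in 𝓝[≠] (z : ℂ), (f ∘ ofComplex) w = 0) : f = 0 := by
  have := (analyticOnNhd_comp_ofComplex hf).eqOn_zero_of_preconnected_of_frequently_eq_zero
    isPreconnected_upperHalfPlaneSet z.2 h
  ext w
  rw [← comp_ofComplex_coe f w]
  exact this w.2

/-- The identity theorem: a holomorphic function vanishing on `Im τ > 1` is zero. -/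
lemma eq_zero_of_halfPlane {f : ℍ → ℂ} (hf : MDiff f) (h : ∀ z : halfPlane, f (pt z) = 0) :
    f = 0 := by
  obtain ⟨z⟩ := (inferInstance : Nonempty halfPlane)
  refine eq_zero_of_frequently_comp hf (pt z) ?_
  refine Eventually.frequently (eventually_nhdsWithin_of_eventually_nhds ?_)
  filter_upwards [isOpen_halfPlane.mem_nhds z.2] with w hw
  have := h ⟨w, hw⟩
  rwa [← comp_ofComplex_coe f] at this

lemma eq_of_halfPlane {f g : ℍ → ℂ} (hf : MDiff f) (hg : MDiff g)
    (h : ∀ z : halfPlane, f (pt z) = g (pt z)) : f = g :=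
  sub_eq_zero.mp (eq_zero_of_halfPlane (hf.sub hg) fun z => sub_eq_zero.mpr (h z))

lemma eventually_ne_zero {f : ℍ → ℂ} (hf : MDiff f) (hf0 : f ≠ 0) (z : ℍ) :
    ∀ᶠ w in 𝓝[≠] (z : ℂ), (f ∘ ofComplex) w ≠ 0 := by
  by_contra h
  exact hf0 (eq_zero_of_frequently_comp hf z h)

lemma mdiff_E {k : ℕ} (hk : 3 ≤ k) : MDiff (E hk) := ModularFormClass.holo (E hk)

lemma mdiff_discriminant : MDiff discriminant := CuspForm.discriminant.holo'

lemma E_smul {k : ℕ} (hk : 3 ≤ k) (γ : SL(2, ℤ)) (z : ℍ) :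
    E hk (γ • z) = denom γ z ^ k * E hk z := by
  have h := congrFun (slash_E hk γ) z
  rw [SL_slash_apply, zpow_neg, zpow_natCast] at h
  rw [← h, mul_comm, inv_mul_cancel_right₀ (pow_ne_zero _ (denom_ne_zero _ _))]

lemma denom_T (z : ℍ) : denom ModularGroup.T z = 1 := by
  rw [ModularGroup.denom_apply]
  simp [ModularGroup.T]

lemma E_T_smul {k : ℕ} (hk : 3 ≤ k) (z : ℍ) : E hk (ModularGroup.T • z) = E hk z := by
  rw [E_smul, denom_T, one_pow, one_mul]

lemma E2_T_smul (z : ℍ) : E2 (ModularGroup.T • z) = E2 z := by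
  rw [E2_smul, denom_T]
  simp [ModularGroup.T]

lemma E_S_smul {k : ℕ} (hk : 3 ≤ k) (z : ℍ) : E hk (ModularGroup.S • z) = z ^ k * E hk z := by
  rw [E_smul, ModularGroup.denom_S]

lemma E2_S_smul (z : ℍ) :
    E2 (ModularGroup.S • z) = z ^ 2 * E2 z + 12 * (2 * π * I)⁻¹ * z := by
  rw [E2_smul, ModularGroup.denom_S]
  simp [ModularGroup.S]

lemma E₄_ne_zero_of_E₆_eq_zero {z : ℍ} (h : E₆ z = 0) : E₄ z ≠ 0 := fun h4 =>
  discriminant_ne_zero z (by rw [discriminant_eq_E₄_cube_sub_E₆_sq, h, h4]; simp)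

lemma E₆_ne_zero_of_E₄_eq_zero {z : ℍ} (h : E₄ z = 0) : E₆ z ≠ 0 := fun h6 =>
  E₄_ne_zero_of_E₆_eq_zero h6 h

/-- S fixes i, where the transformation law of E₂ reads E₂(i) = −E₂(i) + 6/π. -/
lemma E2_I_ne_zero : E2 UpperHalfPlane.I ≠ 0 := by
  intro h0
  have h := E2_S_smul UpperHalfPlane.I
  have h3 : ModularGroup.S • UpperHalfPlane.I = UpperHalfPlane.I :=
    ModularGroup.stabilizer_I.mpr (by simp)
  rw [h3, h0, coe_I] at h
  simp [Complex.I_ne_zero] at h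

/-- Two zeros of `E₄` at which `E₂` takes nonzero values with ratio `3`. -/
lemma exists_zeros_E₄ : ∃ z w : ℍ, E₄ z = 0 ∧ E₄ w = 0 ∧ E2 z ≠ 0 ∧ E2 w = 3 * E2 z := by
  -- The cube root of unity ρ: there −1/ρ = ρ + 1, so S and T agree at ρ. Comparing the two
  -- transformation laws gives E₄(ρ) = 0 and determines E₂(ρ).
  let r : ℂ := ⟨-1 / 2, √3 / 2⟩
  have hr : r ^ 2 + r + 1 = 0 := by
    have h3 : √3 * √3 = 3 := Real.mul_self_sqrt (by norm_num)
    apply Complex.ext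
    · simp [r, pow_two]
      linear_combination (-1 / 4) * h3
    · simp [r, pow_two]
      ring
  have him : 0 < r.im := by simp [r]
  have hr0 : r ≠ 0 := fun h => by simp [h] at him
  have hr1 : r - 1 ≠ 0 := fun h => by
    rw [sub_eq_zero.mp h] at him
    simp at him
  let z : ℍ := ⟨r, him⟩
  let w : ℍ := ⟨r - 1, by simpa using him⟩
  have hz : (z : ℂ) = r := rfl
  have hw : (w : ℂ) = r - 1 := rfl
  have hST : ModularGroup.S • z = ModularGroup.T • z := by
    ext
    rw [modular_S_smul, modular_T_smul]
    simp only [coe_vadd, hz]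
    push_cast
    rw [inv_eq_iff_eq_inv, eq_comm]
    exact inv_eq_of_mul_eq_one_right (by linear_combination -hr)
  have hTw : ModularGroup.T • w = z := by
    ext
    rw [modular_T_smul]
    simp [hz, hw]
  have hE4 : E₄ z = 0 := by
    have h := E_S_smul (k := 4) (by norm_num) z
    rw [hST, E_T_smul, hz] at h
    have h' : E₄ z * (r - 1) = 0 := by
      linear_combination -h - E₄ z * (r ^ 2 - r) * hr
    exact (mul_eq_zero.mp h').resolve_right hr1
  have hE2 : E2 z * (1 - r ^ 2) = 12 * (2 * π * I)⁻¹ * r := by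
    have h := E2_S_smul z
    rw [hST, E2_T_smul, hz] at h
    linear_combination h
  have hE4w : E₄ w = 0 := by
    rw [← E_T_smul (k := 4) (by norm_num) w, hTw, hE4]
  have hE2w : E2 w = E2 z := by
    rw [← E2_T_smul w, hTw]
  -- On the orbit of ρ one has E₂ = 3/(π Im τ). Since |ρ − 1|² = 3, the point S(ρ − 1) has a third
  -- of the imaginary part of ρ, whence the ratio 3.
  refine ⟨z, ModularGroup.S • w, hE4, ?_, fun h0 => ?_, ?_⟩
  · rw [E_S_smul, hE4w, mul_zero]
  · rw [h0, zero_mul] at hE2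
    simp [hr0, Complex.I_ne_zero] at hE2
  · rw [E2_S_smul, hE2w, hw]
    refine mul_left_cancel₀ hr0 ?_
    linear_combination (1 - r) * hE2 - E2 z * hr

end UpperHalfPlaneFunctions

/-! ### Residues at the zeros of E₄ and E₆. -/

section Residues

open ModularForm MatrixGroups EisensteinSeries Derivative Filter Topology

/-- A derivative of a meromorphic function has no simple pole. -/
lemma tendsto_sub_mul_deriv {v : ℂ → ℂ} {z₀ L : ℂ} (hv : MeromorphicAt v z₀)
    (h : Tendsto (fun z => (z - z₀) * deriv v z) (𝓝[≠] z₀) (𝓝 L)) : L = 0 := by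
  have hid : Tendsto (fun z => z - z₀) (𝓝[≠] z₀) (𝓝 0) := by
    have : ContinuousAt (fun z => z - z₀) z₀ := by fun_prop
    simpa using this.tendsto.mono_left nhdsWithin_le_nhds
  have hm : MeromorphicAt (fun z => z - z₀) z₀ := by fun_prop
  -- Without a pole of `v` the limit is 0; with a pole of `v`, its derivative has a pole of order at
  -- least 2, and no limit could exist.
  by_cases h0 : 0 ≤ meromorphicOrderAt v z₀
  · obtain ⟨g, hg, hvg⟩ := (hv.meromorphicOrderAt_nonneg_iff).mp h0
    have h1 : Tendsto (deriv v) (𝓝[≠] z₀) (𝓝 (deriv g z₀)) :=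
      (hg.deriv.continuousAt.tendsto.mono_left nhdsWithin_le_nhds).congr' hvg.nhdsNE_deriv.symm
    have := hid.mul h1
    rw [zero_mul] at this
    exact tendsto_nhds_unique h this
  · rw [not_le] at h0
    obtain ⟨n, hn⟩ := WithTop.ne_top_iff_exists.mp (ne_top_of_lt h0)
    have hn0 : n < 0 := by
      rw [← hn] at h0
      exact_mod_cast h0
    have h1 := meromorphicOrderAt_deriv_eq_sub_one (𝕜 := ℂ) (Int.cast_ne_zero.mpr hn0.ne) hn.symm
    have h2 := (tendsto_nhds_iff_meromorphicOrderAt_nonneg (hm.mul hv.deriv)).mp ⟨L, h⟩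
    have h3 : meromorphicOrderAt (fun z => z - z₀) z₀ = 1 := meromorphicOrderAt_id_sub_const
    rw [meromorphicOrderAt_mul hm hv.deriv, h1, h3] at h2
    have h4 : (0 : ℤ) ≤ 1 + (n - 1) := by exact_mod_cast h2
    omega

/-- At a simple zero of `h`, the residue of `A / h + B` is `A z₀ / h'`, and a derivative has no
residue. -/
lemma numerator_eq_zero {v h A B : ℂ → ℂ} {z₀ h' : ℂ} (hv : MeromorphicAt v z₀)
    (hh : HasDerivAt h h' z₀) (h0 : h z₀ = 0) (hh' : h' ≠ 0) (hA : ContinuousAt A z₀)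
    (hB : ContinuousAt B z₀) (hd : ∀ᶠ z in 𝓝[≠] z₀, deriv v z = A z / h z + B z) : A z₀ = 0 := by
  have hid : Tendsto (fun z => z - z₀) (𝓝[≠] z₀) (𝓝 0) := by
    have : ContinuousAt (fun z => z - z₀) z₀ := by fun_prop
    simpa using this.tendsto.mono_left nhdsWithin_le_nhds
  have hs : Tendsto (fun z => (z - z₀) / h z) (𝓝[≠] z₀) (𝓝 h'⁻¹) := by
    refine ((hasDerivAt_iff_tendsto_slope.mp hh).inv₀ hh').congr fun z => ?_
    rw [slope_def_field, h0, sub_zero, inv_div]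
  have hlim := (hs.mul (hA.tendsto.mono_left nhdsWithin_le_nhds)).add
    (hid.mul (hB.tendsto.mono_left nhdsWithin_le_nhds))
  rw [zero_mul, add_zero] at hlim
  have := tendsto_sub_mul_deriv hv (hlim.congr' ?_)
  · exact (mul_eq_zero.mp this).resolve_left (inv_ne_zero hh')
  · filter_upwards [hd] with z hz
    rw [hz]
    ring

lemma eventually_im_pos (z : ℍ) : ∀ᶠ w in 𝓝[≠] (z : ℂ), 0 < w.im :=
  eventually_nhdsWithin_of_eventually_nhds (isOpen_upperHalfPlaneSet.mem_nhds z.2)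

lemma hasDerivAt_E2 (z : ℍ) : HasDerivAt (E2 ∘ ofComplex)
    (2 * π * I * ((E2 z ^ 2 - E₄ z) / 12)) z :=
  D_E2 z ▸ hasDerivAt_comp_ofComplex E2_mdifferentiable z

lemma hasDerivAt_E₄ (z : ℍ) : HasDerivAt (E₄ ∘ ofComplex)
    (2 * π * I * ((E2 z * E₄ z - E₆ z) / 3)) z :=
  D_E₄ z ▸ hasDerivAt_comp_ofComplex (mdiff_E _) z

lemma hasDerivAt_E₆ (z : ℍ) : HasDerivAt (E₆ ∘ ofComplex)
    (2 * π * I * ((E2 z * E₆ z - E₄ z ^ 2) / 2)) z :=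
  D_E₆ z ▸ hasDerivAt_comp_ofComplex (mdiff_E _) z

lemma coe_E₄_ne_zero : (E₄ : ℍ → ℂ) ≠ 0 := fun h =>
  E₄_ne_zero_of_E₆_eq_zero E₆_I (congrFun h _)

lemma coe_E₆_ne_zero : (E₆ : ℍ → ℂ) ≠ 0 := fun h => by
  obtain ⟨z, -, h4z, -⟩ := exists_zeros_E₄
  exact E₆_ne_zero_of_E₄_eq_zero h4z (congrFun h z)

/-- If a combination of the three meromorphic modular forms is the derivative of a function which
is meromorphic at a zero of `E₆`, then the residue of `F4b` there does not contribute. -/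
lemma residue_E₆ {u : ℂ → ℂ} {z₀ : ℍ} (h6 : E₆ z₀ = 0) (hu : MeromorphicAt u z₀) {c₁ c₂ c₃ : ℂ}
    (hd : ∀ᶠ z in 𝓝[≠] (z₀ : ℂ), HasDerivAt u (2 * π * I * (c₁ * F4a (ofComplex z) +
      c₂ * F4b (ofComplex z) + c₃ * F6 (ofComplex z))) z) :
    c₂ * E2 z₀ = 0 := by
  have h4 := E₄_ne_zero_of_E₆_eq_zero h6
  have a2 := analyticAt_comp_ofComplex E2_mdifferentiable z₀
  have a4 := analyticAt_comp_ofComplex (mdiff_E (k := 4) (by norm_num)) z₀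
  have a6 := analyticAt_comp_ofComplex (mdiff_E (k := 6) (by norm_num)) z₀
  have aΔ := analyticAt_comp_ofComplex mdiff_discriminant z₀
  have key := numerator_eq_zero (z₀ := z₀)
    -- F₄b has a double pole with leading term E₄⁴/(1728 E₆²), while D(E₄²/E₆) begins with
    -- E₄⁴/(2E₆²). Subtracting c₂/864 times E₄²/E₆ leaves at most a simple pole.
    (v := u - fun z => c₂ / 864 * ((E₄ ∘ ofComplex) z ^ 2 / (E₆ ∘ ofComplex) z))
    (A := fun z => -(2 * π * I) * c₂ / 5184 * ((E2 ∘ ofComplex) z * (E₄ ∘ ofComplex) z ^ 2))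
    (B := fun z => 2 * π * I * (c₁ * ((discriminant ∘ ofComplex) z / (E₄ ∘ ofComplex) z ^ 2) +
      c₃ * ((E₆ ∘ ofComplex) z * (discriminant ∘ ofComplex) z / (E₄ ∘ ofComplex) z ^ 3) +
      c₂ / 5184 * (E₄ ∘ ofComplex) z))
    (hu.sub ((MeromorphicAt.const _ _).mul ((a4.meromorphicAt.pow 2).div a6.meromorphicAt)))
    (hasDerivAt_E₆ z₀) (by rw [comp_ofComplex_coe, h6]) ?_ ?_ ?_ ?_
  · simp only [comp_ofComplex_coe] at key
    have key' : 2 * π * I * (c₂ * E2 z₀ * E₄ z₀ ^ 2) = 0 := by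
      linear_combination -5184 * key
    exact (mul_eq_zero.mp ((mul_eq_zero.mp key').resolve_left
      Complex.two_pi_I_ne_zero)).resolve_right (pow_ne_zero _ h4)
  · rw [h6]
    simp [h4]
  · exact (continuousAt_const.mul (a2.continuousAt.mul (a4.continuousAt.pow 2)))
  · have h4' : (E₄ ∘ ofComplex) z₀ ≠ 0 := by rwa [comp_ofComplex_coe]
    exact continuousAt_const.mul (((continuousAt_const.mul
      (aΔ.continuousAt.div (a4.continuousAt.pow 2) (pow_ne_zero _ h4'))).add
      (continuousAt_const.mul ((a6.continuousAt.mul aΔ.continuousAt).div (a4.continuousAt.pow 3)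
        (pow_ne_zero _ h4')))).add (continuousAt_const.mul a4.continuousAt))
  · filter_upwards [hd, eventually_im_pos z₀, eventually_ne_zero (mdiff_E _) coe_E₄_ne_zero z₀,
      eventually_ne_zero (mdiff_E _) coe_E₆_ne_zero z₀] with z hz him h4z h6z
    lift z to ℍ using him
    have := hz.sub ((((hasDerivAt_E₄ z).fun_pow 2).fun_div (hasDerivAt_E₆ z) h6z).const_mul (c₂ / 864))
    rw [this.deriv]
    simp only [comp_ofComplex_coe] at h4z h6z ⊢
    simp only [ofComplex_apply, F4a, F4b, F6, discriminant_eq_E₄_cube_sub_E₆_sq]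
    field_simp
    ring

/-- If a combination of the three meromorphic modular forms is the derivative of a function which
is meromorphic at a zero of `E₄`, then the residues of `F4a` and `F6` there cancel. -/
lemma residue_E₄ {u : ℂ → ℂ} {z₀ : ℍ} (h4 : E₄ z₀ = 0) (hu : MeromorphicAt u z₀) {c₁ c₂ c₃ : ℂ}
    (hd : ∀ᶠ z in 𝓝[≠] (z₀ : ℂ), HasDerivAt u (2 * π * I * (c₁ * F4a (ofComplex z) +
      c₂ * F4b (ofComplex z) + c₃ * F6 (ofComplex z))) z) :
    E2 z₀ * (4 * c₁ - 3 * c₃ * E2 z₀) = 0 := by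
  have h6 := E₆_ne_zero_of_E₄_eq_zero h4
  have a2 := analyticAt_comp_ofComplex E2_mdifferentiable z₀
  have a4 := analyticAt_comp_ofComplex (mdiff_E (k := 4) (by norm_num)) z₀
  have a6 := analyticAt_comp_ofComplex (mdiff_E (k := 6) (by norm_num)) z₀
  have aΔ := analyticAt_comp_ofComplex mdiff_discriminant z₀
  have key := numerator_eq_zero (z₀ := z₀)
    -- E₆/E₄ removes the double pole of F₄ₐ. For F₆ the term with E₄² below removes the triple pole,
    -- and E₂E₆/E₄ the double pole that remains; `A` is the numerator of what is left.
    (v := u + fun z => c₁ / 576 * ((E₆ ∘ ofComplex) z / (E₄ ∘ ofComplex) z) -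
      c₃ / 1152 * (((E₄ ∘ ofComplex) z ^ 3 - (E₆ ∘ ofComplex) z ^ 2) / (E₄ ∘ ofComplex) z ^ 2 +
        (E2 ∘ ofComplex) z * (E₆ ∘ ofComplex) z / (E₄ ∘ ofComplex) z))
    (A := fun z => 2 * π * I / 13824 * ((E2 ∘ ofComplex) z *
      (4 * c₁ - 3 * c₃ * (E2 ∘ ofComplex) z) * (E₆ ∘ ofComplex) z))
    (B := fun z => 2 * π * I * (-c₁ / 3456 * (E₄ ∘ ofComplex) z +
      c₂ * ((E₄ ∘ ofComplex) z * (discriminant ∘ ofComplex) z / (E₆ ∘ ofComplex) z ^ 2) +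
      c₃ / 13824 * (2 * (E2 ∘ ofComplex) z * (E₄ ∘ ofComplex) z + (E₆ ∘ ofComplex) z)))
    (hu.add (((MeromorphicAt.const _ _).mul (a6.meromorphicAt.div a4.meromorphicAt)).sub
      ((MeromorphicAt.const _ _).mul ((((a4.meromorphicAt.pow 3).sub (a6.meromorphicAt.pow 2)).div
        (a4.meromorphicAt.pow 2)).add ((a2.meromorphicAt.mul a6.meromorphicAt).div
          a4.meromorphicAt)))))
    (hasDerivAt_E₄ z₀) (by rw [comp_ofComplex_coe, h4]) ?_ ?_ ?_ ?_
  · simp only [comp_ofComplex_coe] at key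
    refine (mul_eq_zero.mp ((mul_eq_zero.mp key).resolve_left ?_)).resolve_right h6
    exact div_ne_zero Complex.two_pi_I_ne_zero (by norm_num)
  · rw [h4]
    simp [h6]
  · have := a2.continuousAt
    exact continuousAt_const.mul ((this.mul (continuousAt_const.sub
      (continuousAt_const.mul this))).mul a6.continuousAt)
  · have h6' : (E₆ ∘ ofComplex) z₀ ≠ 0 := by rwa [comp_ofComplex_coe]
    exact continuousAt_const.mul (((continuousAt_const.mul a4.continuousAt).add
      (continuousAt_const.mul ((a4.continuousAt.mul aΔ.continuousAt).div (a6.continuousAt.pow 2)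
        (pow_ne_zero _ h6')))).add (continuousAt_const.mul
          (((continuousAt_const.mul a2.continuousAt).mul a4.continuousAt).add a6.continuousAt)))
  · filter_upwards [hd, eventually_im_pos z₀, eventually_ne_zero (mdiff_E _) coe_E₄_ne_zero z₀,
      eventually_ne_zero (mdiff_E _) coe_E₆_ne_zero z₀] with z hz him h4z h6z
    lift z to ℍ using him
    have d4 := hasDerivAt_E₄ z
    have d6 := hasDerivAt_E₆ z
    have := hz.add (((d6.fun_div d4 h4z).const_mul (c₁ / 576)).fun_sub
      (((((d4.fun_pow 3).fun_sub (d6.fun_pow 2)).fun_div (d4.fun_pow 2) (pow_ne_zero _ h4z)).fun_add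
        (((hasDerivAt_E2 z).fun_mul d6).fun_div d4 h4z)).const_mul (c₃ / 1152)))
    rw [this.deriv]
    simp only [comp_ofComplex_coe] at h4z h6z ⊢
    simp only [ofComplex_apply, F4a, F4b, F6, discriminant_eq_E₄_cube_sub_E₆_sq]
    field_simp
    ring

end Residues

/-! ### Fields closed under a derivation. -/

section Stable

variable {k K : Type*} [Field k] [Field K] [Algebra k K]

lemma map_mem_adjoin (D : Derivation k K K) {S : Set K}
    (hS : ∀ x ∈ S, D x ∈ IntermediateField.adjoin k S) {x : K}
    (hx : x ∈ IntermediateField.adjoin k S) : D x ∈ IntermediateField.adjoin k S := by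
  induction hx using IntermediateField.adjoin_induction with
  | mem x hx => exact hS x hx
  | algebraMap c =>
    rw [Derivation.map_algebraMap]
    exact zero_mem _
  | add x y _ _ h1 h2 =>
    rw [map_add]
    exact add_mem h1 h2
  | inv x hx h =>
    rw [Derivation.leibniz_inv]
    exact mul_mem (neg_mem (pow_mem (inv_mem hx) 2)) h
  | mul x y hx hy h1 h2 =>
    rw [Derivation.leibniz]
    exact add_mem (mul_mem hx h2) (mul_mem hy h1)

lemma differentialAdjoin_eq_adjoin (D : Derivation k K K) {S : Set K}
    (hS : ∀ x ∈ S, D x ∈ IntermediateField.adjoin k S) :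
    differentialAdjoin D S = IntermediateField.adjoin k S := by
  refine le_antisymm (sInf_le ⟨IntermediateField.subset_adjoin k S,
    fun x hx => map_mem_adjoin D hS hx⟩) ?_
  exact IntermediateField.adjoin_le_iff.mpr (subset_differentialAdjoin D S)

end Stable

/-! ### Quotients of holomorphic functions on ℍ, and the constants of δ. -/

section GlobalFunctions

open ModularForm MatrixGroups EisensteinSeries Derivative Filter Topology

lemma restrict_apply {f : ℍ → ℂ} (hf : MDiff f) (z : halfPlane) : (restrict f hf).1 z = f (pt z) :=
  rfl

lemma delta_algebraMap (f : Hol) : delta (algebraMap Hol Mer f) = algebraMap Hol Mer (deltaHol f) :=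
  fracDerivation_algebraMap deltaHol f

lemma deltaHol_restrict {f : ℍ → ℂ} (hf : MDiff f) : deltaHol (restrict f hf) =
    restrict (D f) (normalizedDerivOfComplex_mdifferentiable hf) := by
  ext z
  change (2 * π * I)⁻¹ * deriv (ext (restrict f hf)) z = (2 * π * I)⁻¹ * deriv (f ∘ ofComplex) z
  rw [(ext_eventuallyEq (g := f ∘ ofComplex) (fun w => ?_) z).deriv_eq]
  exact (comp_ofComplex_coe f (pt w)).symm

/-- The algebra of functions on `Im τ > 1` that extend to holomorphic functions on the upper half
plane. -/
def GlobalHol : Subalgebra ℂ Hol where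
  carrier := {h | ∃ (f : ℍ → ℂ) (hf : MDiff f), restrict f hf = h}
  mul_mem' := by
    rintro _ _ ⟨f, hf, rfl⟩ ⟨g, hg, rfl⟩
    exact ⟨f * g, hf.mul hg, rfl⟩
  add_mem' := by
    rintro _ _ ⟨f, hf, rfl⟩ ⟨g, hg, rfl⟩
    exact ⟨f + g, hf.add hg, rfl⟩
  algebraMap_mem' := fun c => ⟨fun _ => c, mdifferentiable_const, rfl⟩

/-- The field of quotients of holomorphic functions on the upper half plane. -/
def GlobalMer : IntermediateField ℂ Mer :=
  IntermediateField.adjoin ℂ (algebraMap Hol Mer '' GlobalHol)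

lemma algebraMap_mem_GlobalMer {f : ℍ → ℂ} (hf : MDiff f) :
    algebraMap Hol Mer (restrict f hf) ∈ GlobalMer :=
  IntermediateField.subset_adjoin _ _ ⟨_, ⟨f, hf, rfl⟩, rfl⟩

lemma delta_mem_GlobalMer {x : Mer} (hx : x ∈ GlobalMer) : delta x ∈ GlobalMer := by
  refine map_mem_adjoin delta ?_ hx
  rintro _ ⟨_, ⟨f, hf, rfl⟩, rfl⟩
  rw [delta_algebraMap, deltaHol_restrict]
  exact algebraMap_mem_GlobalMer _

/-- `GlobalHol` is already an algebra, so the field it generates consists of its quotients. -/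
lemma exists_of_mem_GlobalMer {y : Hol} (h : algebraMap Hol Mer y ∈ GlobalMer) :
    ∃ (f g : ℍ → ℂ) (hf : MDiff f) (hg : MDiff g), g ≠ 0 ∧ y * restrict g hg = restrict f hf := by
  have hA : Algebra.adjoin ℂ (algebraMap Hol Mer '' GlobalHol) =
      GlobalHol.map (IsScalarTower.toAlgHom ℂ Hol Mer) :=
    Algebra.adjoin_eq (GlobalHol.map (IsScalarTower.toAlgHom ℂ Hol Mer))
  obtain ⟨a, ha, b, hb, hab⟩ := IntermediateField.mem_adjoin_iff_div.mp h
  rw [hA] at ha hb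
  obtain ⟨_, ⟨f, hf, rfl⟩, rfl⟩ := ha
  obtain ⟨_, ⟨g, hg, rfl⟩, rfl⟩ := hb
  change algebraMap Hol Mer y = algebraMap Hol Mer _ / algebraMap Hol Mer _ at hab
  -- Division by zero gives 0, so here `y = 0`, which is written as 0/1.
  by_cases hg0 : g = 0
  · refine ⟨0, 1, mdifferentiable_const, mdifferentiable_const, one_ne_zero, ?_⟩
    have h0 : restrict g hg = 0 := by
      subst hg0
      rfl
    have hy : y = 0 := by
      refine IsFractionRing.injective Hol Mer ?_
      rw [hab, h0, map_zero, div_zero]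
    rw [hy, zero_mul]
    rfl
  · refine ⟨f, g, hf, hg, hg0, IsFractionRing.injective Hol Mer ?_⟩
    have h0 : restrict g hg ≠ 0 := fun h0 => hg0 (eq_zero_of_halfPlane hg fun z => by
      rw [← restrict_apply hg, h0]
      rfl)
    rw [map_mul, hab, div_mul_cancel₀]
    exact fun h => h0 (IsFractionRing.injective Hol Mer (h.trans (map_zero _).symm))

lemma E₄_pt_ne_zero (z : halfPlane) : E₄ (pt z) ≠ 0 := by
  rw [← cusp_q]
  exact cusp_E₄_ne_zero (norm_q_lt z.2)

lemma E₆_pt_ne_zero (z : halfPlane) : E₆ (pt z) ≠ 0 := by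
  rw [← cusp_q]
  exact cusp_E₆_ne_zero (norm_q_lt z.2)

/-- No nontrivial combination of the three meromorphic modular forms has an antiderivative which
is meromorphic on the upper half plane. -/
theorem combination_eq_zero {y : Hol} {c₁ c₂ c₃ : ℂ} (hy : ∀ z, (deltaHol y).1 z =
      c₁ * F4a (pt z) + c₂ * F4b (pt z) + c₃ * F6 (pt z))
    (hmem : algebraMap Hol Mer y ∈ GlobalMer) : c₁ = 0 ∧ c₂ = 0 ∧ c₃ = 0 := by
  obtain ⟨f, g, hf, hg, hg0, hyg⟩ := exists_of_mem_GlobalMer hmem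
  have hDf := normalizedDerivOfComplex_mdifferentiable hf
  have hDg := normalizedDerivOfComplex_mdifferentiable hg
  have h4 : MDiff E₄ := mdiff_E (by norm_num)
  have h6 : MDiff E₆ := mdiff_E (by norm_num)
  have hΔ := mdiff_discriminant
  have hloc : ∀ z : halfPlane, g (pt z) * D f (pt z) - f (pt z) * D g (pt z) =
      g (pt z) ^ 2 * (c₁ * F4a (pt z) + c₂ * F4b (pt z) + c₃ * F6 (pt z)) := fun z => by
    have h1 := congrArg deltaHol hyg
    rw [Derivation.leibniz, deltaHol_restrict, deltaHol_restrict] at h1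
    have h2 : y.1 z * D g (pt z) + g (pt z) * (deltaHol y).1 z = D f (pt z) :=
      congrFun (congrArg Subtype.val h1) z
    have h3 : y.1 z * g (pt z) = f (pt z) := congrFun (congrArg Subtype.val hyg) z
    rw [hy] at h2
    rw [← h2, ← h3]
    ring
  -- With denominators cleared both sides are holomorphic on ℍ, and the identity theorem carries the
  -- relation from Im τ > 1 down to the zeros of E₄ and E₆.
  have hglob : (g * D f - f * D g) * (⇑E₄ * ⇑E₄ * ⇑E₄ * (⇑E₆ * ⇑E₆)) =
      g * g * (discriminant * ((fun _ => c₁) * (⇑E₄ * (⇑E₆ * ⇑E₆)) +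
        (fun _ => c₂) * (⇑E₄ * ⇑E₄ * (⇑E₄ * ⇑E₄)) + (fun _ => c₃) * (⇑E₆ * ⇑E₆ * ⇑E₆))) := by
    refine eq_of_halfPlane (((hg.mul hDf).sub (hf.mul hDg)).mul (((h4.mul h4).mul h4).mul
      (h6.mul h6))) ((hg.mul hg).mul (hΔ.mul (((mdifferentiable_const.mul
        (h4.mul (h6.mul h6))).add (mdifferentiable_const.mul ((h4.mul h4).mul (h4.mul h4)))).add
          (mdifferentiable_const.mul ((h6.mul h6).mul h6))))) fun z => ?_
    have h4z := E₄_pt_ne_zero z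
    have h6z := E₆_pt_ne_zero z
    simp only [Pi.mul_apply, Pi.sub_apply, Pi.add_apply, hloc, F4a, F4b, F6]
    field_simp
  have hu : ∀ z : ℍ, MeromorphicAt (fun w => (f ∘ ofComplex) w / (g ∘ ofComplex) w) z := fun z =>
    (analyticAt_comp_ofComplex hf z).meromorphicAt.div
      (analyticAt_comp_ofComplex hg z).meromorphicAt
  have hd : ∀ z₀ : ℍ, ∀ᶠ z in 𝓝[≠] (z₀ : ℂ),
      HasDerivAt (fun w => (f ∘ ofComplex) w / (g ∘ ofComplex) w) (2 * π * I *
        (c₁ * F4a (ofComplex z) + c₂ * F4b (ofComplex z) + c₃ * F6 (ofComplex z))) z := fun z₀ => by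
    filter_upwards [eventually_im_pos z₀, eventually_ne_zero (mdiff_E _) coe_E₄_ne_zero z₀,
      eventually_ne_zero (mdiff_E _) coe_E₆_ne_zero z₀, eventually_ne_zero hg hg0 z₀]
      with z him h4z h6z hgz
    lift z to ℍ using him
    refine ((hasDerivAt_comp_ofComplex hf z).fun_div (hasDerivAt_comp_ofComplex hg z)
      hgz).congr_deriv ?_
    have h1 := congrFun hglob z
    simp only [Pi.mul_apply, Pi.sub_apply, Pi.add_apply] at h1
    simp only [comp_ofComplex_coe] at h4z h6z hgz ⊢
    simp only [ofComplex_apply, F4a, F4b, F6]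
    field_simp
    linear_combination h1
  have hc₂ := (mul_eq_zero.mp (residue_E₆ E₆_I (hu _) (hd _))).resolve_right E2_I_ne_zero
  -- With e = E₂(z), the two residues give 4c₁ = 3c₃e and 4c₁ = 9c₃e.
  obtain ⟨z, w, hz, hw, hz2, hw2⟩ := exists_zeros_E₄
  have e1 := (mul_eq_zero.mp (residue_E₄ hz (hu _) (hd _))).resolve_left hz2
  have e2 := (mul_eq_zero.mp (residue_E₄ hw (hu _) (hd _))).resolve_left
    (by rw [hw2]; exact mul_ne_zero three_ne_zero hz2)
  rw [hw2] at e2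
  have hc₃ : c₃ = 0 := by
    have : c₃ * E2 z = 0 := by linear_combination (e1 - e2) / 6
    exact (mul_eq_zero.mp this).resolve_right hz2
  refine ⟨?_, hc₂, hc₃⟩
  rw [hc₃] at e1
  linear_combination e1 / 4

/-- The constants of the differential field `Mer` are the complex numbers. -/
lemma exists_eq_of_delta_eq_zero {x : Mer} (hx : delta x = 0) : ∃ c : ℂ, x = algebraMap ℂ Mer c := by
  obtain ⟨a, b, hb, rfl⟩ := IsFractionRing.div_surjective (A := Hol) x
  have hb0 : b ≠ 0 := nonZeroDivisors.ne_zero hb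
  have hb0' : algebraMap Hol Mer b ≠ 0 := fun h =>
    hb0 (IsFractionRing.injective Hol Mer (h.trans (map_zero _).symm))
  have h1 : deltaHol a * b = a * deltaHol b := by
    refine IsFractionRing.injective Hol Mer ?_
    have h2 : algebraMap Hol Mer a = algebraMap Hol Mer a / algebraMap Hol Mer b *
      algebraMap Hol Mer b := (div_mul_cancel₀ _ hb0').symm
    have h3 := congrArg delta h2
    rw [Derivation.leibniz, hx, smul_zero, add_zero, delta_algebraMap, delta_algebraMap,
      smul_eq_mul] at h3
    rw [map_mul, map_mul, h3]
    field_simp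
  obtain ⟨z₀, hz₀⟩ : ∃ z, b.1 z ≠ 0 := by
    by_contra! h
    exact hb0 (Subtype.ext (funext h))
  have hmero : ∀ z : ℂ, z ∈ halfPlane → ext b z ≠ 0 →
      HasDerivAt (fun w => ext a w / ext b w) 0 z := fun z hz hbz => by
    have ha' := (differentiableAt_ext a ⟨z, hz⟩).hasDerivAt
    have hb' := (differentiableAt_ext b ⟨z, hz⟩).hasDerivAt
    refine (ha'.fun_div hb' hbz).congr_deriv ?_
    have h4 : (2 * π * I)⁻¹ * deriv (ext a) z * b.1 ⟨z, hz⟩ =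
      a.1 ⟨z, hz⟩ * ((2 * π * I)⁻¹ * deriv (ext b) z) :=
      congrFun (congrArg Subtype.val h1) ⟨z, hz⟩
    rw [← ext_apply b.1, ← ext_apply a.1] at h4
    have h5 : deriv (ext a) z * ext b z = ext a z * deriv (ext b) z := by
      refine mul_left_cancel₀ (inv_ne_zero Complex.two_pi_I_ne_zero) ?_
      linear_combination h4
    rw [h5, sub_self, zero_div]
  -- The quotient a/b is constant on a disc free of zeros of b; the identity theorem then gives a =
  -- c b on the whole half-plane, zeros of b included.
  have hbc : ContinuousAt (ext b) z₀ := (differentiableAt_ext b z₀).continuousAt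
  have hne : ∀ᶠ z in 𝓝 (z₀ : ℂ), z ∈ halfPlane ∧ ext b z ≠ 0 :=
    Filter.Eventually.and (isOpen_halfPlane.mem_nhds z₀.2) (hbc.eventually_ne (by rwa [ext_apply]))
  obtain ⟨r, hr, hball⟩ := Metric.eventually_nhds_iff_ball.mp hne
  set c := ext a z₀ / ext b z₀ with hc
  have hconst : ∀ z ∈ Metric.ball (z₀ : ℂ) r, ext a z / ext b z = c := fun z hz =>
    (convex_ball (z₀ : ℂ) r).is_const_of_fderivWithin_eq_zero (𝕜 := ℂ)
      (fun w hw => (hmero w (hball w hw).1 (hball w hw).2).differentiableAt.differentiableWithinAt)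
      (fun w hw => by
        have := (hmero w (hball w hw).1 (hball w hw).2).hasDerivWithinAt
          (s := Metric.ball (z₀ : ℂ) r)
        rw [this.hasFDerivWithinAt.fderivWithin (Metric.isOpen_ball.uniqueDiffWithinAt hw)]
        ext
        simp) hz (Metric.mem_ball_self hr)
  have heq : Set.EqOn (ext a) (fun z => c * ext b z) halfPlane := by
    refine ((differentiableOn_ext a.2).analyticOnNhd isOpen_halfPlane).eqOn_of_preconnected_of_eventuallyEq
      (((differentiableOn_ext b.2).const_mul c).analyticOnNhd isOpen_halfPlane)
      isPreconnected_halfPlane z₀.2 ?_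
    filter_upwards [Metric.ball_mem_nhds _ hr] with z hz
    rw [← hconst z hz, div_mul_cancel₀ _ (hball z hz).2]
  refine ⟨c, ?_⟩
  rw [div_eq_iff hb0', IsScalarTower.algebraMap_apply ℂ Hol Mer, ← map_mul]
  congr 1
  ext z
  have := heq z.2
  rw [ext_apply] at this
  simp only [ext_apply] at this
  exact this

end GlobalFunctions

/-! ### Algebraic independence of τ, q, E₂, E₄, E₆. -/

section BaseIndependence

open ModularForm MatrixGroups EisensteinSeries Derivative Filter Topology

lemma deltaHol_E2Hol : deltaHol E2Hol = (1 / 12 : ℂ) • (E2Hol ^ 2 - E4Hol) := by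
  rw [E2Hol, deltaHol_restrict]
  ext z
  refine (D_E2 (pt z)).trans ?_
  change _ = (1 / 12 : ℂ) * (E2 (pt z) ^ 2 - E₄ (pt z))
  ring

lemma deltaHol_E4Hol : deltaHol E4Hol = (1 / 3 : ℂ) • (E2Hol * E4Hol - E6Hol) := by
  rw [E4Hol, deltaHol_restrict]
  ext z
  refine (D_E₄ (pt z)).trans ?_
  change _ = (1 / 3 : ℂ) * (E2 (pt z) * E₄ (pt z) - E₆ (pt z))
  ring

lemma deltaHol_E6Hol : deltaHol E6Hol = (1 / 2 : ℂ) • (E2Hol * E6Hol - E4Hol ^ 2) := by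
  rw [E6Hol, deltaHol_restrict]
  ext z
  refine (D_E₆ (pt z)).trans ?_
  change _ = (1 / 2 : ℂ) * (E2 (pt z) * E₆ (pt z) - E₄ (pt z) ^ 2)
  ring

/-- The quotient `E₆² / E₄³` takes infinitely many values on `Im τ > 1`. -/
lemma infinite_range_E₆_sq_div_E₄_cube :
    (Set.range fun z : halfPlane => E₆ (pt z) ^ 2 / E₄ (pt z) ^ 3).Infinite := by
  have : PreconnectedSpace halfPlane := Subtype.preconnectedSpace isPreconnected_halfPlane
  have hc : ∀ {f : Hol}, Continuous f.1 := fun {f} => by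
    have := (differentiableOn_ext f.2).continuousOn.domRestrict
    refine this.congr fun z => ext_apply f.1 z
  have hcont : Continuous fun z : halfPlane => E₆ (pt z) ^ 2 / E₄ (pt z) ^ 3 :=
    ((hc (f := E6Hol)).pow 2).div ((hc (f := E4Hol)).pow 3) fun z =>
      pow_ne_zero _ (E₄_pt_ne_zero z)
  -- A connected set with two points is infinite. Were the quotient a constant c, differentiating
  -- E₆² = cE₄³ would give c = 1, hence Δ = 0.
  refine (isPreconnected_range hcont).infinite_of_nontrivial ?_
  by_contra hnt
  rw [Set.not_nontrivial_iff] at hnt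
  obtain ⟨z₀⟩ := (inferInstance : Nonempty halfPlane)
  set c := E₆ (pt z₀) ^ 2 / E₄ (pt z₀) ^ 3 with hcdef
  have heq : ∀ z, E₆ (pt z) ^ 2 = c * E₄ (pt z) ^ 3 := fun z => by
    have := hnt ⟨z, rfl⟩ ⟨z₀, rfl⟩
    simp only at this
    rw [div_eq_iff (pow_ne_zero _ (E₄_pt_ne_zero z))] at this
    exact this
  have hH : E6Hol ^ 2 = c • E4Hol ^ 3 := by
    ext z
    exact heq z
  have h1 := congrArg deltaHol hH
  rw [Derivation.leibniz_pow, Derivation.map_smul, Derivation.leibniz_pow, deltaHol_E4Hol,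
    deltaHol_E6Hol] at h1
  have h2 := congrFun (congrArg Subtype.val h1) z₀
  replace h2 : 2 • (E₆ (pt z₀) ^ 1 * (1 / 2 * (E2 (pt z₀) * E₆ (pt z₀) - E₄ (pt z₀) ^ 2))) =
    c * (3 • (E₄ (pt z₀) ^ 2 * (1 / 3 * (E2 (pt z₀) * E₄ (pt z₀) - E₆ (pt z₀))))) := h2
  simp only [nsmul_eq_mul] at h2
  push_cast at h2
  have h3 : (c - 1) * (E₄ (pt z₀) ^ 2 * E₆ (pt z₀)) = 0 := by
    linear_combination h2 - E2 (pt z₀) * heq z₀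
  have hc1 := (mul_eq_zero.mp h3).resolve_right
    (mul_ne_zero (pow_ne_zero _ (E₄_pt_ne_zero z₀)) (E₆_pt_ne_zero z₀))
  refine discriminant_ne_zero (pt z₀) ?_
  rw [discriminant_eq_E₄_cube_sub_E₆_sq, heq]
  linear_combination (-E₄ (pt z₀) ^ 3 / 1728) * hc1

open MvPolynomial in
/-- A polynomial in five variables that vanishes at infinitely many points of a polynomial curve
vanishes along the curve. -/
lemma eval_curve_eq_zero (p : MvPolynomial (Fin 5) ℂ) (a b c d e : Polynomial ℂ) {S : Set ℂ}
    (hS : S.Infinite)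
    (h : ∀ w ∈ S, eval ![a.eval w, b.eval w, c.eval w, d.eval w, e.eval w] p = 0) (w : ℂ) :
    eval ![a.eval w, b.eval w, c.eval w, d.eval w, e.eval w] p = 0 := by
  have key : ∀ w, (aeval ![a, b, c, d, e] p : Polynomial ℂ).eval w =
      eval ![a.eval w, b.eval w, c.eval w, d.eval w, e.eval w] p := fun w => by
    have h1 : ((Polynomial.aeval w : Polynomial ℂ →ₐ[ℂ] ℂ).comp (aeval ![a, b, c, d, e])) =
        aeval ![a.eval w, b.eval w, c.eval w, d.eval w, e.eval w] := by
      refine algHom_ext fun i => ?_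
      fin_cases i <;> simp
    have h2 := DFunLike.congr_fun h1 p
    rw [AlgHom.comp_apply, Polynomial.coe_aeval_eq_eval] at h2
    exact h2
  have h0 : (aeval ![a, b, c, d, e] p : Polynomial ℂ) = 0 := by
    refine Polynomial.eq_zero_of_infinite_isRoot _ (hS.mono fun w hw => ?_)
    rw [Set.mem_ofPred_eq, Polynomial.IsRoot, key]
    exact h w hw
  rw [← key, h0, Polynomial.eval_zero]

/-- The matrix with rows `(1, m)` and `(c, 1 + c m)`. -/
def lowerMatrix (c m : ℤ) : SL(2, ℤ) :=
  ⟨!![1, m; c, 1 + c * m], by rw [Matrix.det_fin_two_of]; ring⟩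

lemma denom_lowerMatrix (c m : ℤ) (z : ℍ) : denom (lowerMatrix c m) z = c * z + (1 + c * m) := by
  rw [ModularGroup.denom_apply]
  simp [lowerMatrix]

lemma coe_lowerMatrix_smul (c m : ℤ) (z : ℍ) :
    ((lowerMatrix c m • z : ℍ) : ℂ) = (z + m) / (c * z + (1 + c * m)) := by
  rw [UpperHalfPlane.coe_specialLinearGroup_apply]
  simp [lowerMatrix]

lemma E2_lowerMatrix (c m : ℤ) (z : ℍ) : E2 (lowerMatrix c m • z) =
    (c * z + (1 + c * m)) ^ 2 * E2 z + 12 * (2 * π * I)⁻¹ * c * (c * z + (1 + c * m)) := by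
  rw [E2_smul, denom_lowerMatrix]
  simp [lowerMatrix]

lemma E_lowerMatrix {k : ℕ} (hk : 3 ≤ k) (c m : ℤ) (z : ℍ) : E hk (lowerMatrix c m • z) =
    (c * z + (1 + c * m)) ^ k * E hk z := by
  rw [E_smul, denom_lowerMatrix]

lemma infinite_range_add_mul_intCast (a : ℂ) {c : ℂ} (hc : c ≠ 0) :
    (Set.range fun m : ℤ => a + c * m).Infinite :=
  Set.infinite_range_of_injective fun m n h => by simpa [hc] using h

open MvPolynomial in
lemma meromorphicAt_eval {ι : Type*} (p : MvPolynomial ι ℂ) {v : ι → ℂ → ℂ} {z : ℂ}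
    (hv : ∀ i, MeromorphicAt (v i) z) : MeromorphicAt (fun w => eval (fun i => v i w) p) z := by
  induction p using MvPolynomial.induction_on with
  | C a => simp
  | add p q hp hq => simpa using! hp.add hq
  | mul_X p i hp => simpa using! hp.mul (hv i)

open MvPolynomial in
lemma differentiableAt_eval {ι : Type*} (p : MvPolynomial ι ℂ) {v : ι → ℂ → ℂ} {z : ℂ}
    (hv : ∀ i, DifferentiableAt ℂ (v i) z) :
    DifferentiableAt ℂ (fun w => eval (fun i => v i w) p) z := by
  induction p using MvPolynomial.induction_on with
  | C a => simp
  | add p q hp hq => simpa using! hp.add hq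
  | mul_X p i hp => simpa using! hp.mul (hv i)

/-! ### Freeing the variables of a polynomial relation one at a time. -/

section Vanishing

open MvPolynomial

variable {p : MvPolynomial (Fin 5) ℂ}

/-- The constant `6 / (π i)` of the transformation law of `E₂`. -/
def kappa : ℂ := 12 * (2 * π * I)⁻¹

lemma kappa_ne_zero : kappa ≠ 0 :=
  mul_ne_zero (by norm_num) (inv_ne_zero Complex.two_pi_I_ne_zero)

lemma exp_add_int (z : ℂ) (m : ℤ) : cexp (2 * π * I * (z + m)) = cexp (2 * π * I * z) := by
  rw [mul_add, Complex.exp_add, mul_comm _ (m : ℂ), Complex.exp_int_mul_two_pi_mul_I, mul_one]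

/-- Translations τ ↦ τ + m change only the first variable, which therefore runs through infinitely
many values. -/
lemma eval_tau_free (h : ∀ τ : ℍ, eval ![(τ : ℂ), cexp (2 * π * I * τ), E2 τ, E₄ τ, E₆ τ] p = 0)
    (x : ℂ) (τ : ℍ) : eval ![x, cexp (2 * π * I * τ), E2 τ, E₄ τ, E₆ τ] p = 0 := by
  have := eval_curve_eq_zero p Polynomial.X (Polynomial.C (cexp (2 * π * I * τ)))
    (Polynomial.C (E2 τ)) (Polynomial.C (E₄ τ)) (Polynomial.C (E₆ τ))
    (infinite_range_add_mul_intCast τ one_ne_zero) (by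
      rintro _ ⟨m, rfl⟩
      have hm := h (lowerMatrix 0 m • τ)
      rw [coe_lowerMatrix_smul, E2_lowerMatrix, E_lowerMatrix, E_lowerMatrix] at hm
      simp only [Int.cast_zero, zero_mul, mul_zero, zero_add, add_zero, div_one, one_pow, one_mul,
        exp_add_int] at hm
      simpa using hm) x
  simpa using this

/-- With τ fixed, the images of τ under `lowerMatrix 1 n` are 1 − v for v = 1/(τ + 1 + n). These v
accumulate at 0, where the relation is meromorphic in v, so it persists for all v ≠ 0. -/
lemma eval_inversion {x : ℂ} (h : ∀ τ : ℍ, eval ![x, cexp (2 * π * I * τ), E2 τ, E₄ τ, E₆ τ] p = 0)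
    (τ : ℍ) {v : ℂ} (hv : v ≠ 0) : eval ![x, cexp (2 * π * I * -v),
      v⁻¹ ^ 2 * E2 τ + kappa * v⁻¹, v⁻¹ ^ 4 * E₄ τ, v⁻¹ ^ 6 * E₆ τ] p = 0 := by
  let f : Fin 5 → ℂ → ℂ := ![fun _ => x, fun v => cexp (2 * π * I * -v),
    fun v => v⁻¹ ^ 2 * E2 τ + kappa * v⁻¹, fun v => v⁻¹ ^ 4 * E₄ τ, fun v => v⁻¹ ^ 6 * E₆ τ]
  have hf : ∀ v, (fun i => f i v) = ![x, cexp (2 * π * I * -v),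
      v⁻¹ ^ 2 * E2 τ + kappa * v⁻¹, v⁻¹ ^ 4 * E₄ τ, v⁻¹ ^ 6 * E₆ τ] := fun v => by
    ext i
    fin_cases i <;> rfl
  have hexp : AnalyticAt ℂ (fun v : ℂ => cexp (2 * π * I * -v)) 0 := by fun_prop
  have hinv : MeromorphicAt (fun v : ℂ => v⁻¹) 0 := by fun_prop
  have hmero : MeromorphicAt (fun v => eval (fun i => f i v) p) 0 := by
    refine meromorphicAt_eval p fun i => ?_
    fin_cases i
    · exact MeromorphicAt.const x 0
    · exact hexp.meromorphicAt
    · exact ((hinv.pow 2).mul (MeromorphicAt.const _ _)).add ((MeromorphicAt.const _ _).mul hinv)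
    · exact (hinv.pow 4).mul (MeromorphicAt.const _ _)
    · exact (hinv.pow 6).mul (MeromorphicAt.const _ _)
  have hdiff : DifferentiableOn ℂ (fun v => eval (fun i => f i v) p) {0}ᶜ := fun v hv => by
    refine (differentiableAt_eval p fun i => ?_).differentiableWithinAt
    have hv' : v ≠ 0 := hv
    have hi : DifferentiableAt ℂ (fun v : ℂ => v⁻¹) v := differentiableAt_inv hv'
    have he : DifferentiableAt ℂ (fun v : ℂ => cexp (2 * π * I * -v)) v := by fun_prop
    fin_cases i
    · exact differentiableAt_const x
    · exact he
    · exact ((hi.pow 2).mul_const _).add (hi.const_mul _)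
    · exact (hi.pow 4).mul_const _
    · exact (hi.pow 6).mul_const _
  have hne : ∀ n : ℕ, (τ : ℂ) + (1 + n) ≠ 0 := fun n h0 => by
    have := congrArg Complex.im h0
    simp at this
    exact τ.im_ne_zero this
  have hlim : Tendsto (fun n : ℕ => ((τ : ℂ) + (1 + n))⁻¹) atTop (𝓝[≠] 0) := by
    refine tendsto_nhdsWithin_iff.mpr ⟨?_, Eventually.of_forall fun n => inv_ne_zero (hne n)⟩
    refine tendsto_inv₀_cobounded.comp ?_
    have h1 : Tendsto (fun n : ℕ => (n : ℂ)) atTop (Bornology.cobounded ℂ) := by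
      rw [← tendsto_norm_atTop_iff_cobounded]
      simpa using tendsto_natCast_atTop_atTop (R := ℝ)
    refine (tendsto_const_add_cobounded ((τ : ℂ) + 1)).comp h1 |>.congr fun n => ?_
    simp [add_assoc]
  have hfreq : ∃ᶠ v in 𝓝[≠] (0 : ℂ), eval (fun i => f i v) p = 0 := by
    refine hlim.frequently (Frequently.of_forall fun n => ?_)
    have hm := h (lowerMatrix 1 n • τ)
    rw [coe_lowerMatrix_smul, E2_lowerMatrix, E_lowerMatrix, E_lowerMatrix] at hm
    have hq : ((τ : ℂ) + (n : ℤ)) / (((1 : ℤ) : ℂ) * τ + (1 + ((1 : ℤ) : ℂ) * (n : ℤ))) =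
        -((τ : ℂ) + (1 + n))⁻¹ + ((1 : ℤ) : ℂ) := by
      have := hne n
      push_cast
      rw [one_mul, one_mul]
      field_simp
      ring
    rw [hq, exp_add_int] at hm
    rw [hf]
    simpa [kappa] using hm
  have hev := hmero.frequently_zero_iff_eventuallyEq_zero.mp hfreq
  obtain ⟨v₀, hv₀, hv₀'⟩ :=
    ((eventually_eventually_nhdsWithin.mpr hev).and self_mem_nhdsWithin).exists
  rw [isOpen_compl_singleton.nhdsWithin_eq hv₀'] at hv₀
  have hpre : IsPreconnected ({0}ᶜ : Set ℂ) :=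
    (isConnected_compl_singleton_of_one_lt_rank (by simp) 0).isPreconnected
  have := (hdiff.analyticOnNhd isOpen_compl_singleton).eqOn_zero_of_preconnected_of_eventuallyEq_zero
    hpre hv₀' hv₀ hv
  rw [← hf]
  exact this

/-- Replacing v by v + m keeps the exponential but moves w = 1/v, so the value s of q and the
variable w become independent. -/
lemma eval_exp_free {x : ℂ} {a b c : ℂ} (h : ∀ v : ℂ, v ≠ 0 → eval ![x, cexp (2 * π * I * -v),
      v⁻¹ ^ 2 * a + kappa * v⁻¹, v⁻¹ ^ 4 * b, v⁻¹ ^ 6 * c] p = 0) {s : ℂ} (hs : s ≠ 0) (w : ℂ) :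
    eval ![x, s, w ^ 2 * a + kappa * w, w ^ 4 * b, w ^ 6 * c] p = 0 := by
  obtain ⟨v, hv⟩ : ∃ v, cexp (2 * π * I * -v) = s :=
    ⟨-(Complex.log s / (2 * π * I)), by
      rw [neg_neg, mul_div_cancel₀ _ Complex.two_pi_I_ne_zero, Complex.exp_log hs]⟩
  have hinf : ((fun u : ℂ => u⁻¹) '' ((Set.range fun m : ℤ => v + 1 * (m : ℂ)) \ {0})).Infinite :=
    ((infinite_range_add_mul_intCast v one_ne_zero).sdiff (Set.finite_singleton 0)).image
      inv_injective.injOn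
  have := eval_curve_eq_zero p (Polynomial.C x) (Polynomial.C s)
    (Polynomial.X ^ 2 * Polynomial.C a + Polynomial.C kappa * Polynomial.X)
    (Polynomial.X ^ 4 * Polynomial.C b) (Polynomial.X ^ 6 * Polynomial.C c) hinf (by
      rintro _ ⟨_, ⟨⟨m, rfl⟩, hm⟩, rfl⟩
      have h1 := h _ hm
      have h2 : cexp (2 * π * I * -(v + 1 * (m : ℂ))) = s := by
        rw [one_mul, neg_add, ← Int.cast_neg, exp_add_int, hv]
      rw [h2] at h1
      simpa only [Polynomial.eval_add, Polynomial.eval_mul, Polynomial.eval_pow, Polynomial.eval_X,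
      Polynomial.eval_C, inv_pow] using h1) w
  simpa only [Polynomial.eval_add, Polynomial.eval_mul, Polynomial.eval_pow, Polynomial.eval_X,
      Polynomial.eval_C] using this

lemma eval_q_free (h : ∀ τ : ℍ, eval ![(τ : ℂ), cexp (2 * π * I * τ), E2 τ, E₄ τ, E₆ τ] p = 0)
    (x : ℂ) {s : ℂ} (hs : s ≠ 0) (τ : ℍ) : eval ![x, s, E2 τ, E₄ τ, E₆ τ] p = 0 := by
  have h1 : ∀ τ : ℍ, eval ![x, s, E2 (ModularGroup.S • τ), E₄ (ModularGroup.S • τ),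
      E₆ (ModularGroup.S • τ)] p = 0 := fun τ => by
    rw [E2_S_smul, E_S_smul, E_S_smul]
    exact eval_exp_free (fun v hv => eval_inversion (fun τ => eval_tau_free h x τ) τ hv) hs τ
  -- The curve of `eval_exp_free` at w = τ is the transformation law under S, and every point of ℍ
  -- is an image under S.
  have := h1 (ModularGroup.S⁻¹ • τ)
  rwa [smul_inv_smul] at this

/-- For matrices with lower left entry n + 1, the automorphy factor takes infinitely many values w;
afterwards n + 1 itself is replaced by an arbitrary c. The freedom of c then makes the value of E₂
arbitrary. -/
lemma eval_weight_free {x s : ℂ} (h : ∀ τ : ℍ, eval ![x, s, E2 τ, E₄ τ, E₆ τ] p = 0) (τ : ℍ)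
    (c w : ℂ) : eval ![x, s, w ^ 2 * E2 τ + kappa * c * w, w ^ 4 * E₄ τ, w ^ 6 * E₆ τ] p = 0 := by
  have h1 : ∀ (n : ℕ) (w : ℂ), eval ![x, s, w ^ 2 * E2 τ + kappa * (n + 1) * w, w ^ 4 * E₄ τ,
      w ^ 6 * E₆ τ] p = 0 := fun n w => by
    have hn : ((n : ℂ) + 1) ≠ 0 := Nat.cast_add_one_ne_zero n
    have := eval_curve_eq_zero p (Polynomial.C x) (Polynomial.C s)
      (Polynomial.X ^ 2 * Polynomial.C (E2 τ) + Polynomial.C (kappa * (n + 1)) * Polynomial.X)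
      (Polynomial.X ^ 4 * Polynomial.C (E₄ τ)) (Polynomial.X ^ 6 * Polynomial.C (E₆ τ))
      (infinite_range_add_mul_intCast ((n + 1) * τ + 1) hn) (by
        rintro _ ⟨m, rfl⟩
        have hm := h (lowerMatrix (n + 1) m • τ)
        rw [E2_lowerMatrix, E_lowerMatrix, E_lowerMatrix] at hm
        have hd : ((n + 1 : ℤ) : ℂ) * τ + (1 + ((n + 1 : ℤ) : ℂ) * m) =
            (n + 1) * τ + 1 + (n + 1) * m := by
          push_cast
          ring
        have hn' : ((n + 1 : ℤ) : ℂ) = n + 1 := by push_cast; ring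
        rw [hd, hn'] at hm
        simp only [Polynomial.eval_add, Polynomial.eval_mul, Polynomial.eval_pow, Polynomial.eval_X,
      Polynomial.eval_C]
        exact hm) w
    simpa only [Polynomial.eval_add, Polynomial.eval_mul, Polynomial.eval_pow, Polynomial.eval_X,
      Polynomial.eval_C] using this
  have hinf : (Set.range fun n : ℕ => (n : ℂ) + 1).Infinite :=
    Set.infinite_range_of_injective fun m n h => by simpa using h
  have := eval_curve_eq_zero p (Polynomial.C x) (Polynomial.C s)
    (Polynomial.C (w ^ 2 * E2 τ) + Polynomial.C kappa * Polynomial.X * Polynomial.C w)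
    (Polynomial.C (w ^ 4 * E₄ τ)) (Polynomial.C (w ^ 6 * E₆ τ)) hinf (by
      rintro _ ⟨n, rfl⟩
      simpa using h1 n w) c
  simpa using this

lemma eval_E2_free {x s : ℂ} (h : ∀ τ : ℍ, eval ![x, s, E2 τ, E₄ τ, E₆ τ] p = 0) (τ : ℍ)
    (X : ℂ) {w : ℂ} (hw : w ≠ 0) : eval ![x, s, X, w ^ 4 * E₄ τ, w ^ 6 * E₆ τ] p = 0 := by
  have := eval_weight_free h τ ((X - w ^ 2 * E2 τ) / (kappa * w)) w
  have hk := kappa_ne_zero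
  rwa [show w ^ 2 * E2 τ + kappa * ((X - w ^ 2 * E2 τ) / (kappa * w)) * w = X by
    field_simp
    ring] at this

/-- Scaling by w preserves E₆²/E₄³, and this quotient takes infinitely many values. After
normalising the fourth variable to Y, the last one still takes infinitely many. -/
lemma eval_free {x s : ℂ} (h : ∀ τ : ℍ, eval ![x, s, E2 τ, E₄ τ, E₆ τ] p = 0)
    (X : ℂ) {Y : ℂ} (hY : Y ≠ 0) (Z : ℂ) : eval ![x, s, X, Y, Z] p = 0 := by
  have hinf : {Z : ℂ | eval ![x, s, X, Y, Z] p = 0}.Infinite := by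
    refine Set.Infinite.of_image (fun Z => Z ^ 2 / Y ^ 3)
      (infinite_range_E₆_sq_div_E₄_cube.mono ?_)
    rintro _ ⟨z, rfl⟩
    have h4 := E₄_pt_ne_zero z
    obtain ⟨w, hw⟩ := IsAlgClosed.exists_pow_nat_eq (Y / E₄ (pt z)) (n := 4) (by norm_num)
    have hw0 : w ≠ 0 := by
      rintro rfl
      rw [zero_pow (by norm_num)] at hw
      exact div_ne_zero hY h4 hw.symm
    have hwY : w ^ 4 * E₄ (pt z) = Y := by rw [hw, div_mul_cancel₀ _ h4]
    refine ⟨w ^ 6 * E₆ (pt z), ?_, ?_⟩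
    · have := eval_E2_free h (pt z) X hw0
      rwa [hwY] at this
    · simp only [← hwY]
      field_simp
  have := eval_curve_eq_zero p (Polynomial.C x) (Polynomial.C s) (Polynomial.C X) (Polynomial.C Y)
    Polynomial.X hinf (fun Z hZ => by simpa using! hZ) Z
  simpa using this

/-- The functions `τ`, `q`, `E₂`, `E₄` and `E₆` satisfy no polynomial relation. -/
theorem eq_zero_of_eval_eq_zero
    (h : ∀ τ : ℍ, eval ![(τ : ℂ), cexp (2 * π * I * τ), E2 τ, E₄ τ, E₆ τ] p = 0) : p = 0 := by
  -- The excluded values q = 0 and E₄ = 0 are absorbed by the factor `X 1 * X 3`.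
  have h1 : X 1 * X 3 * p = 0 := by
    refine MvPolynomial.funext fun v => ?_
    rw [map_mul, map_mul, eval_X, eval_X, map_zero]
    by_cases hs : v 1 = 0
    · rw [hs, zero_mul, zero_mul]
    by_cases hY : v 3 = 0
    · rw [hY, mul_zero, zero_mul]
    have hv : v = ![v 0, v 1, v 2, v 3, v 4] := by
      ext i
      fin_cases i <;> rfl
    have := eval_free (fun τ => eval_q_free h (v 0) hs τ) (v 2) hY (v 4)
    rw [← hv] at this
    rw [this, mul_zero]
  exact (mul_eq_zero.mp h1).resolve_left (mul_ne_zero (X_ne_zero _) (X_ne_zero _))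

end Vanishing

lemma mdifferentiable_eval (p : MvPolynomial (Fin 5) ℂ) : MDiff fun τ : ℍ =>
    MvPolynomial.eval ![(τ : ℂ), cexp (2 * π * I * τ), E2 τ, E₄ τ, E₆ τ] p := by
  rw [UpperHalfPlane.mdifferentiable_iff]
  intro z hz
  let f : Fin 5 → ℂ → ℂ := ![fun z => z, fun z => cexp (2 * π * I * z), E2 ∘ ofComplex,
    E₄ ∘ ofComplex, E₆ ∘ ofComplex]
  have hf : DifferentiableAt ℂ (fun w => MvPolynomial.eval (fun i => f i w) p) z := by
    refine differentiableAt_eval p fun i => ?_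
    fin_cases i
    · exact differentiableAt_id
    · exact (show DifferentiableAt ℂ (fun z : ℂ => cexp (2 * π * I * z)) z by fun_prop)
    · exact (analyticAt_comp_ofComplex E2_mdifferentiable ⟨z, hz⟩).differentiableAt
    · exact (analyticAt_comp_ofComplex (mdiff_E _) ⟨z, hz⟩).differentiableAt
    · exact (analyticAt_comp_ofComplex (mdiff_E _) ⟨z, hz⟩).differentiableAt
  refine DifferentiableAt.differentiableWithinAt (hf.congr_of_eventuallyEq ?_)
  filter_upwards [isOpen_upperHalfPlaneSet.mem_nhds hz] with w hw
  rw [Function.comp_apply]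
  congr 2
  ext i
  fin_cases i <;> simp [f, ofComplex_apply_of_im_pos hw]

theorem algebraicIndependent_base :
    AlgebraicIndependent ℂ ![tauHol, qHol, E2Hol, E4Hol, E6Hol] := by
  rw [algebraicIndependent_iff]
  intro p hp
  refine eq_zero_of_eval_eq_zero fun τ => ?_
  -- The relation is given on Im τ > 1 only; it must hold on ℍ before SL₂(ℤ) can act on it.
  refine congrFun (eq_zero_of_halfPlane (mdifferentiable_eval p) fun z => ?_) τ
  let ev : Hol →ₐ[ℂ] ℂ := (Pi.evalAlgHom ℂ (fun _ : halfPlane => ℂ) z).comp Hol.val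
  have h1 : ev.comp (MvPolynomial.aeval ![tauHol, qHol, E2Hol, E4Hol, E6Hol]) =
      MvPolynomial.aeval ![((pt z : ℍ) : ℂ), cexp (2 * π * I * (pt z : ℍ)), E2 (pt z), E₄ (pt z),
        E₆ (pt z)] := by
    refine MvPolynomial.algHom_ext fun i => ?_
    rw [AlgHom.comp_apply, MvPolynomial.aeval_X, MvPolynomial.aeval_X]
    fin_cases i <;> rfl
  have h2 := DFunLike.congr_fun h1 p
  rw [AlgHom.comp_apply, hp, map_zero] at h2
  exact h2.symm

end BaseIndependence

/-! ### The eight generators and the transcendence degree. -/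

section TranscendenceDegree

open ModularForm MatrixGroups EisensteinSeries Derivative

lemma isAlgebraic_adjoin_of_intermediateField {k K : Type*} [Field k] [Field K] [Algebra k K]
    {S : Set K} {L : IntermediateField k K} (hL : L = IntermediateField.adjoin k S) {T : Set L}
    (hT : (L.val '' T) = S) : Algebra.IsAlgebraic (Algebra.adjoin k T) L := by
  refine ⟨fun x => ?_⟩
  have hx : (x : K) ∈ IntermediateField.adjoin k S := hL ▸ x.2
  have hA : Algebra.adjoin k S = (Algebra.adjoin k T).map L.val := by
    rw [← hT, AlgHom.map_adjoin]
  obtain ⟨r, hr, s, hs, hrs⟩ := IntermediateField.mem_adjoin_iff_div.mp hx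
  rw [hA] at hr hs
  obtain ⟨r, hr, rfl⟩ := hr
  obtain ⟨s, hs, rfl⟩ := hs
  have : x = algebraMap (Algebra.adjoin k T) L ⟨r, hr⟩ *
      (algebraMap (Algebra.adjoin k T) L ⟨s, hs⟩)⁻¹ := by
    ext
    rw [hrs, div_eq_mul_inv]
    rfl
  rw [this]
  exact (isAlgebraic_algebraMap _).mul (isAlgebraic_algebraMap _).inv

/-- Every element of the field is a quotient of polynomials in the generators, so independent
generators form a transcendence basis. -/
lemma trdeg_adjoin_eq_card {k : Type*} {ι K : Type} [Field k] [Field K] [Algebra k K] [Fintype ι]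
    {x : ι → K} (hx : AlgebraicIndependent k x) {L : IntermediateField k K}
    (hL : L = IntermediateField.adjoin k (Set.range x)) :
    Algebra.trdeg k L = Fintype.card ι := by
  have hmem : ∀ i, x i ∈ L := fun i =>
    hL ▸ IntermediateField.subset_adjoin _ _ (Set.mem_range_self i)
  let z : ι → L := fun i => ⟨x i, hmem i⟩
  have hz : AlgebraicIndependent k z := AlgebraicIndependent.of_comp L.val hx
  have : Algebra.IsAlgebraic (Algebra.adjoin k (Set.range z)) L :=
    isAlgebraic_adjoin_of_intermediateField hL (by
      rw [← Set.range_comp]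
      rfl)
  have hb : IsTranscendenceBasis k z := hz.isTranscendenceBasis_iff_isAlgebraic.mpr this
  have := hb.lift_cardinalMk_eq_trdeg
  simpa using this.symm

/-- The discriminant on the half-plane `Im τ > 1`. -/
def discHol : Hol := restrict discriminant mdiff_discriminant

lemma discHol_eq : discHol = (1 / 1728 : ℂ) • (E4Hol ^ 3 - E6Hol ^ 2) := by
  ext z
  refine (discriminant_eq_E₄_cube_sub_E₆_sq (pt z)).trans ?_
  change _ = (1 / 1728 : ℂ) * (E₄ (pt z) ^ 3 - E₆ (pt z) ^ 2)
  ring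

lemma algebraMap_E4Hol_ne_zero : algebraMap Hol Mer E4Hol ≠ 0 := fun h => by
  obtain ⟨z⟩ := (inferInstance : Nonempty halfPlane)
  have h0 : E4Hol = 0 := IsFractionRing.injective Hol Mer (h.trans (map_zero _).symm)
  exact E₄_pt_ne_zero z (congrFun (congrArg Subtype.val h0) z)

lemma algebraMap_E6Hol_ne_zero : algebraMap Hol Mer E6Hol ≠ 0 := fun h => by
  obtain ⟨z⟩ := (inferInstance : Nonempty halfPlane)
  have h0 : E6Hol = 0 := IsFractionRing.injective Hol Mer (h.trans (map_zero _).symm)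
  exact E₆_pt_ne_zero z (congrFun (congrArg Subtype.val h0) z)

lemma delta_antiF4a : delta (algebraMap Hol Mer antiF4a) =
    algebraMap Hol Mer discHol / algebraMap Hol Mer E4Hol ^ 2 := by
  rw [eq_div_iff (pow_ne_zero _ algebraMap_E4Hol_ne_zero), delta_algebraMap, ← map_pow, ← map_mul]
  congr 1
  ext z
  change (deltaHol antiF4a).1 z * E₄ (pt z) ^ 2 = discriminant (pt z)
  rw [deltaHol_antiF4a, F4a, div_mul_cancel₀ _ (pow_ne_zero _ (E₄_pt_ne_zero z))]

lemma delta_antiF4b : delta (algebraMap Hol Mer antiF4b) =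
    algebraMap Hol Mer E4Hol * algebraMap Hol Mer discHol / algebraMap Hol Mer E6Hol ^ 2 := by
  rw [eq_div_iff (pow_ne_zero _ algebraMap_E6Hol_ne_zero), delta_algebraMap, ← map_pow, ← map_mul,
    ← map_mul]
  congr 1
  ext z
  change (deltaHol antiF4b).1 z * E₆ (pt z) ^ 2 = E₄ (pt z) * discriminant (pt z)
  rw [deltaHol_antiF4b, F4b, div_mul_cancel₀ _ (pow_ne_zero _ (E₆_pt_ne_zero z))]

lemma delta_antiF6 : delta (algebraMap Hol Mer antiF6) =
    algebraMap Hol Mer E6Hol * algebraMap Hol Mer discHol / algebraMap Hol Mer E4Hol ^ 3 := by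
  rw [eq_div_iff (pow_ne_zero _ algebraMap_E4Hol_ne_zero), delta_algebraMap, ← map_pow, ← map_mul,
    ← map_mul]
  congr 1
  ext z
  change (deltaHol antiF6).1 z * E₄ (pt z) ^ 3 = E₆ (pt z) * discriminant (pt z)
  rw [deltaHol_antiF6, F6, div_mul_cancel₀ _ (pow_ne_zero _ (E₄_pt_ne_zero z))]

lemma deltaHol_tauHol : deltaHol tauHol = algebraMap ℂ Hol (2 * π * I)⁻¹ := by
  ext z
  change (2 * π * I)⁻¹ * deriv (ext tauHol.1) z = (2 * π * I)⁻¹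
  rw [(ext_eventuallyEq (f := tauHol.1) (g := id) (fun w => rfl) z).deriv_eq, deriv_id, mul_one]

lemma deltaHol_qHol : deltaHol qHol = qHol := by
  ext z
  change (2 * π * I)⁻¹ * deriv (ext qHol.1) z = cexp (2 * π * I * z)
  have h : HasDerivAt (fun w => cexp (2 * π * I * w)) (cexp (2 * π * I * z) * (2 * π * I * 1)) z :=
    ((hasDerivAt_id (z : ℂ)).const_mul (2 * π * I : ℂ)).cexp
  rw [(ext_eventuallyEq (f := qHol.1) (g := fun w => cexp (2 * π * I * w)) (fun w => rfl) z).deriv_eq, h.deriv,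
    mul_one, mul_comm, mul_inv_cancel_right₀ Complex.two_pi_I_ne_zero]

lemma algebraMap_smul_Mer (c : ℂ) (f : Hol) :
    algebraMap Hol Mer (c • f) = algebraMap ℂ Mer c * algebraMap Hol Mer f := by
  rw [Algebra.smul_def, map_mul, ← IsScalarTower.algebraMap_apply]

/-- The generators other than the antiderivatives. -/
def baseFun : Fin 5 → Mer := algebraMap Hol Mer ∘ ![tauHol, qHol, E2Hol, E4Hol, E6Hol]

/-- The three antiderivatives. -/
def antiFun : Fin 3 → Mer := algebraMap Hol Mer ∘ ![antiF4a, antiF4b, antiF6]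

lemma range_generators : Set.range (Sum.elim antiFun baseFun) = algebraMap Hol Mer ''
    {tauHol, qHol, E2Hol, E4Hol, E6Hol, antiF4a, antiF4b, antiF6} := by
  rw [Set.Sum.elim_range, antiFun, baseFun, Set.range_comp, Set.range_comp, ← Set.image_union]
  congr 1
  ext x
  simp only [Matrix.range_cons, Matrix.range_empty, Set.union_empty, Set.mem_union,
    Set.mem_singleton_iff, Set.mem_insert_iff]
  tauto

lemma delta_mem_adjoin_generators {x : Mer} (hx : x ∈ algebraMap Hol Mer ''
      {tauHol, qHol, E2Hol, E4Hol, E6Hol, antiF4a, antiF4b, antiF6}) :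
    delta x ∈ IntermediateField.adjoin ℂ (algebraMap Hol Mer ''
      {tauHol, qHol, E2Hol, E4Hol, E6Hol, antiF4a, antiF4b, antiF6}) := by
  set L := IntermediateField.adjoin ℂ (algebraMap Hol Mer ''
      {tauHol, qHol, E2Hol, E4Hol, E6Hol, antiF4a, antiF4b, antiF6}) with hL
  have hmem : ∀ f ∈ ({tauHol, qHol, E2Hol, E4Hol, E6Hol, antiF4a, antiF4b, antiF6} : Set Hol),
      algebraMap Hol Mer f ∈ L := fun f hf =>
    IntermediateField.subset_adjoin _ _ (Set.mem_image_of_mem _ hf)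
  have h2 := hmem E2Hol (by simp)
  have h4 := hmem E4Hol (by simp)
  have h6 := hmem E6Hol (by simp)
  have hΔ : algebraMap Hol Mer discHol ∈ L := by
    rw [discHol_eq, algebraMap_smul_Mer, map_sub, map_pow, map_pow]
    exact mul_mem (L.algebraMap_mem _) (sub_mem (pow_mem h4 _) (pow_mem h6 _))
  obtain ⟨f, hf, rfl⟩ := hx
  simp only [Set.mem_insert_iff, Set.mem_singleton_iff] at hf
  rcases hf with rfl | rfl | rfl | rfl | rfl | rfl | rfl | rfl
  · rw [delta_algebraMap, deltaHol_tauHol, ← IsScalarTower.algebraMap_apply]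
    exact L.algebraMap_mem _
  · rw [delta_algebraMap, deltaHol_qHol]
    exact hmem qHol (by simp)
  · rw [delta_algebraMap, deltaHol_E2Hol, algebraMap_smul_Mer, map_sub, map_pow]
    exact mul_mem (L.algebraMap_mem _) (sub_mem (pow_mem h2 _) h4)
  · rw [delta_algebraMap, deltaHol_E4Hol, algebraMap_smul_Mer, map_sub, map_mul]
    exact mul_mem (L.algebraMap_mem _) (sub_mem (mul_mem h2 h4) h6)
  · rw [delta_algebraMap, deltaHol_E6Hol, algebraMap_smul_Mer, map_sub, map_mul, map_pow]
    exact mul_mem (L.algebraMap_mem _) (sub_mem (mul_mem h2 h6) (pow_mem h4 _))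
  · rw [delta_antiF4a]
    exact div_mem hΔ (pow_mem h4 _)
  · rw [delta_antiF4b]
    exact div_mem (mul_mem h4 hΔ) (pow_mem h6 _)
  · rw [delta_antiF6]
    exact div_mem (mul_mem h6 hΔ) (pow_mem h4 _)

lemma algebraicIndependent_antiFun : AlgebraicIndependent GlobalMer antiFun := by
  have h4 : algebraMap Hol Mer E4Hol ∈ GlobalMer := algebraMap_mem_GlobalMer _
  have h6 : algebraMap Hol Mer E6Hol ∈ GlobalMer := algebraMap_mem_GlobalMer _
  have hΔ : algebraMap Hol Mer discHol ∈ GlobalMer := algebraMap_mem_GlobalMer _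
  refine algebraicIndependent_of_antiderivatives delta GlobalMer (fun x => delta_mem_GlobalMer)
    (fun x => exists_eq_of_delta_eq_zero) antiFun (fun i => ?_) (fun c hc => ?_)
  · fin_cases i
    · exact delta_antiF4a ▸ div_mem hΔ (pow_mem h4 _)
    · exact delta_antiF4b ▸ div_mem (mul_mem h4 hΔ) (pow_mem h6 _)
    · exact delta_antiF6 ▸ div_mem (mul_mem h6 hΔ) (pow_mem h4 _)
  · have he : ∑ i, algebraMap ℂ Mer (c i) * antiFun i =
        algebraMap Hol Mer (c 0 • antiF4a + c 1 • antiF4b + c 2 • antiF6) := by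
      rw [Fin.sum_univ_three, map_add, map_add, algebraMap_smul_Mer, algebraMap_smul_Mer,
        algebraMap_smul_Mer]
      rfl
    rw [he] at hc
    obtain ⟨e0, e1, e2⟩ := combination_eq_zero (c₁ := c 0) (c₂ := c 1) (c₃ := c 2) (fun z => by
      rw [map_add, map_add, Derivation.map_smul, Derivation.map_smul, Derivation.map_smul]
      change c 0 * (deltaHol antiF4a).1 z + c 1 * (deltaHol antiF4b).1 z +
        c 2 * (deltaHol antiF6).1 z = _
      rw [deltaHol_antiF4a, deltaHol_antiF4b, deltaHol_antiF6]) hc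
    ext i
    fin_cases i
    · exact e0
    · exact e1
    · exact e2

/-- Independence in a tower: the base functions lie in `GlobalMer`, over which the antiderivatives
are still independent. -/
lemma algebraicIndependent_generators : AlgebraicIndependent ℂ (Sum.elim antiFun baseFun) := by
  refine AlgebraicIndependent.sumElim_of_tower (S := GlobalMer) ?_ ?_ algebraicIndependent_antiFun
  · exact algebraicIndependent_base.map' (f := IsScalarTower.toAlgHom ℂ Hol Mer)
      (IsFractionRing.injective Hol Mer)
  · rintro _ ⟨i, rfl⟩
    have hmem : ∀ {f : ℍ → ℂ} (hf : MDiff f), algebraMap Hol Mer (restrict f hf) ∈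
        Set.range (algebraMap GlobalMer Mer) := fun hf => ⟨⟨_, algebraMap_mem_GlobalMer hf⟩, rfl⟩
    fin_cases i
    · exact hmem (f := fun τ => (τ : ℂ)) mdifferentiable_coe
    · refine hmem (f := fun τ => cexp (2 * π * I * τ)) ?_
      rw [UpperHalfPlane.mdifferentiable_iff]
      have : Differentiable ℂ fun z : ℂ => cexp (2 * π * I * z) := by fun_prop
      refine this.differentiableOn.congr fun z hz => ?_
      rw [Function.comp_apply, ofComplex_apply_of_im_pos hz]
    · exact hmem E2_mdifferentiable
    · exact hmem (mdiff_E (by norm_num))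
    · exact hmem (mdiff_E (by norm_num))

end TranscendenceDegree

end MagneticForms

end

open MagneticForms
/-- The differential field `ℂ⟨τ, q, E₂, E₄, E₆, δ⁻¹F_{4a}, δ⁻¹F_{4b}, δ⁻¹F₆⟩` has transcendence
degree `8` over `ℂ`. -/
theorem theorem5 :
    Algebra.trdeg ℂ (differentialAdjoin delta
      (algebraMap Hol Mer ''
        {tauHol, qHol, E2Hol, E4Hol, E6Hol, antiF4a, antiF4b, antiF6})) = 8 := by
  have h := trdeg_adjoin_eq_card algebraicIndependent_generators
    ((differentialAdjoin_eq_adjoin delta fun _ hx => delta_mem_adjoin_generators hx).trans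
      (congrArg _ range_generators.symm))
  simpa using h
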